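/- Let $C$ be a locally presentable category with a cofibrantly generated weak factorization system $(\mathcal L,\mathcal R)$ (so $\mathcal L=l(r(S))$ and $\mathcal R=r(S)$ for some small set $S$ of morphisms, where $r(-)$ and $l(-)$ denote the classes of morphisms with the right, respectively left, lifting property), such that $\emptyset\to X$ lies in $\mathcal L$ for every object $X$. A functorial cylinder on $C$ is an endofunctor $I\colon C\to C$, written $X\mapsto I\otimes X$, with natural transformations $\partial_0,\partial_1\colon \mathrm{id}_C\Rightarrow I$ and $\sigma\colon I\Rightarrow \mathrm{id}_C$ such that $\sigma\partial_0=\sigma\partial_1=\mathrm{id}$ and $(\partial_0,\partial_1)\colon X\sqcup X\to I\otimes X$ is in $\mathcal L$ for every $X$. For $j\colon K\to L$ in $C$ let $$\partial I\boxtimes j\colon (L\sqcup L)\sqcup_{K\sqcup K}(I\otimes K)\to I\otimes L,\qquad \partial_\varepsilon\boxtimes j\colon L\sqcup_{K}(I\otimes K)\to I\otimes L\quad(\varepsilon=0,1)$$ be the induced maps, the second pushout being formed along $\partial_\varepsilon\colon K\to I\otimes K$. The cylinder is exact if $I$ preserves small colimits and $\partial I\boxtimes j$, $\partial_0\boxtimes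 j$, $\partial_1\boxtimes j$ are in $\mathcal L$ for all $j\in\mathcal L$. Fix an exact functorial cylinder. A class of right (respectively left) $I$-anodyne extensions is a class $An\subseteq\mathcal L$ of morphisms such that: $An=l(r(\Lambda))$ for some small set $\Lambda\subseteq\mathcal L$; $\partial_1\boxtimes j\in An$ (respectively $\partial_0\boxtimes j\in An$) for all $j\in\mathcal L$; and $\partial I\boxtimes j\in An$ for all $j\in An$. Given such a class, the right (respectively left) $I$-fibrations are the morphisms with the right lifting property with respect to $An$. **Theorem.** Fix a class of right $I$-anodyne extensions. For every object $A$ of $C$ there exists a unique model structure on the slice category $C/A$ (the Contravariant model structure) whose cofibrations are the morphisms with underlying morphism of $C$ in $\mathcal L$ and whose fibrant objects are the right $I$-fibrations with target $A$. Dually, fix a class of left $I$-anodyne extensions. For every object $A$ of $C$ there exists a unique model structure on $C/A$ (the Covariant model structure) with the same cofibrations and whose fibrant objects are the left $I$-fibrations with target $A$. -/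

import Mathlib

open CategoryTheory Limits HomotopicalAlgebra

universe v u

/-- Locally presentable categories are cocomplete (this is part of their definition). -/
instance hasColimits_of_isLocallyPresentable (C : Type u) [Category.{v} C]
    [IsLocallyPresentable.{v} C] : HasColimitsOfSize.{v, v} C := by
  obtain ⟨κ, _, _⟩ := IsLocallyPresentable.exists_cardinal.{v} C
  exact IsCardinalLocallyPresentable.toHasColimitsOfSize (κ := κ)

namespace DirectedCylinder

/-- `(L, R)` is a weak factorization system which is cofibrantly generated: for some (small) set
`S` of morphisms, `R` is the class `r(S)` of morphisms with the right lifting property with respect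
to `S` and `L` is the class `l(r(S))`. -/
structure IsCofibrantlyGeneratedWFS {C : Type u} [Category.{v} C] (L R : MorphismProperty C) :
    Prop where
  isWeakFactorizationSystem : MorphismProperty.IsWeakFactorizationSystem L R
  exists_generators : ∃ S : MorphismProperty C,
    MorphismProperty.IsSmall.{v} S ∧ R = S.rlp ∧ L = S.rlp.llp

/-- A functorial cylinder object on `C`, relative to a class of morphisms `L`. -/
structure FunctorialCylinder {C : Type u} [Category.{v} C] [HasBinaryCoproducts C]
    (L : MorphismProperty C) where
  /-- the endofunctor `X ↦ I ⊗ X` -/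
  I : C ⥤ C
  /-- the inclusion of the end `0` -/
  d₀ : 𝟭 C ⟶ I
  /-- the inclusion of the end `1` -/
  d₁ : 𝟭 C ⟶ I
  /-- the projection -/
  σ : I ⟶ 𝟭 C
  d₀_σ : d₀ ≫ σ = 𝟙 (𝟭 C)
  d₁_σ : d₁ ≫ σ = 𝟙 (𝟭 C)
  mem (X : C) : L (coprod.desc (d₀.app X) (d₁.app X))

namespace FunctorialCylinder

variable {C : Type u} [Category.{v} C] [HasBinaryCoproducts C] [HasPushouts C]
  {L : MorphismProperty C} (cyl : FunctorialCylinder L)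

/-- The natural map `∂I ⊗ X = X ⨿ X ⟶ I ⊗ X`. -/
noncomputable abbrev bd (X : C) : X ⨿ X ⟶ cyl.I.obj X :=
  coprod.desc (cyl.d₀.app X) (cyl.d₁.app X)

/-- The map `∂I ⊠ j : (∂I ⊗ Y) ⨿_{∂I ⊗ X} (I ⊗ X) ⟶ I ⊗ Y` induced by `j : X ⟶ Y`. -/
noncomputable def bdBox {X Y : C} (j : X ⟶ Y) :
    pushout (coprod.map j j) (cyl.bd X) ⟶ cyl.I.obj Y :=
  pushout.desc (cyl.bd Y) (cyl.I.map j) (by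
    have h₀ := cyl.d₀.naturality j
    have h₁ := cyl.d₁.naturality j
    simp only [Functor.id_map, Functor.id_obj] at h₀ h₁
    ext <;> simp [h₀, h₁])

/-- Given an end `d : id ⟶ I` of the cylinder (in practice `d₀` or `d₁`), the map
`Y ⨿_X (I ⊗ X) ⟶ I ⊗ Y` induced by `j : X ⟶ Y`; this is `∂_ε ⊠ j` for `d = d_ε`. -/
noncomputable def endBox (d : 𝟭 C ⟶ cyl.I) {X Y : C} (j : X ⟶ Y) :
    pushout j (d.app X) ⟶ cyl.I.obj Y :=
  pushout.desc (d.app Y) (cyl.I.map j) (d.naturality j)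

/-- The functorial cylinder is exact with respect to `(L, R)`. -/
structure IsExact : Prop where
  preservesColimits : PreservesColimitsOfSize.{v, v} cyl.I
  bdBox_mem {X Y : C} (j : X ⟶ Y) (hj : L j) : L (cyl.bdBox j)
  endBox_d₀_mem {X Y : C} (j : X ⟶ Y) (hj : L j) : L (cyl.endBox cyl.d₀ j)
  endBox_d₁_mem {X Y : C} (j : X ⟶ Y) (hj : L j) : L (cyl.endBox cyl.d₁ j)

/-- The axioms for a class `An` of `I`-anodyne extensions directed by the end `d`. -/
structure IsAnodyneClass (d : 𝟭 C ⟶ cyl.I) (An : MorphismProperty C) : Prop where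
  le : An ≤ L
  exists_generators : ∃ Λ : MorphismProperty C,
    MorphismProperty.IsSmall.{v} Λ ∧ Λ ≤ L ∧ An = Λ.rlp.llp
  endBox_mem {X Y : C} (j : X ⟶ Y) (hj : L j) : An (cyl.endBox d j)
  bdBox_mem {X Y : C} (j : X ⟶ Y) (hj : An j) : An (cyl.bdBox j)

/-- `An` is a class of right `I`-anodyne extensions. -/
def IsRightAnodyneClass (An : MorphismProperty C) : Prop := cyl.IsAnodyneClass cyl.d₁ An

/-- `An` is a class of left `I`-anodyne extensions. -/
def IsLeftAnodyneClass (An : MorphismProperty C) : Prop := cyl.IsAnodyneClass cyl.d₀ An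

end FunctorialCylinder

end DirectedCylinder

/-! Right and left cases are one argument. `DirectedHomotopy` keeps only the lifting consequences of
the axioms: maps in `An.rlp` (naive fibrations) lift homotopies from the end `d`, while `e` is free.
Exchanging the ends exchanges the two cases, and the structure passes to slices, since a lift over
the base of a map in `Over A` is automatically over `A`.

Weak equivalences are the maps inducing bijections on homotopy classes into naively fibrant objects.
Three sides of a square of homotopies can be completed at the free end, so homotopy of such maps is
an equivalence relation although the cylinder is directed. A naive fibration with fibrant target is
then a weak equivalence iff it is a trivial fibration. Hence being a weak equivalence is a lifting
property of a fibrant replacement (`W.iff_rlp`), and trivial cofibrations form a class of left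
lifting type (`inf_W_eq`).

Smith's method then needs a solution set. Factorizations built in a category of diagrams survive
filtered colimits, so a κ-filtered colimit of arrows is a weak equivalence iff every lifting problem
at one stage is solved at a later one. Closing a stage under solutions and small upper bounds, as in
Löwenheim-Skolem, yields a subdiagram indexed by a fixed small type of terms
(`exists_solution_set`).

For uniqueness, all objects are cofibrant, so weak equivalences are detected by homotopy classes
into fibrant objects, and homotopy can be expressed through cofibrations alone
(`modelCategory_ext`). -/

namespace DirectedCylinder

/-! ### Presentable objects in slices and arrow categories -/

section Presentability

/-- A small family of presentable objects is uniformly presentable, beyond any given cardinal. -/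
lemma exists_regular_cardinal_isCardinalPresentable {C : Type u} [Category.{v} C]
    {ι : Type*} [Small.{v} ι] (X : ι → C) [∀ i, IsPresentable.{v} (X i)] (κ₀ : Cardinal.{v}) :
    ∃ (κ : Cardinal.{v}) (_ : Fact κ.IsRegular), κ₀ ≤ κ ∧
      ∀ i, IsCardinalPresentable (X i) κ := by
  choose k hk hk' using fun i ↦ Functor.IsAccessible.exists_cardinal (F := coyoneda.obj (.op (X i)))
  obtain ⟨κ, h₁, h₂⟩ := HasCardinalLT.exists_regular_cardinal_forall.{v}
    (fun (i : Option (Shrink.{v} ι)) ↦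
      i.elim κ₀.ord.ToType (fun i ↦ (k ((equivShrink _).symm i)).ord.ToType))
  have := Fact.mk h₁
  refine ⟨κ, inferInstance, ?_, fun i ↦ ?_⟩
  · simpa [hasCardinalLT_iff_cardinal_mk_lt] using (h₂ none).le
  · have := hk i
    have := hk' i
    refine isCardinalPresentable_of_le (X i) (κ := k i) ?_
    simpa [hasCardinalLT_iff_cardinal_mk_lt] using (h₂ (some (equivShrink _ i))).le

/-- The small object argument applies to small sets of morphisms with presentable sources. -/
lemma hasSmallObjectArgument_of_isPresentable {C : Type u} [Category.{v} C]
    [HasColimitsOfSize.{v, v} C] (S : MorphismProperty C) [MorphismProperty.IsSmall.{v} S]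
    (hS : ∀ ⦃A B : C⦄ (i : A ⟶ B), S i → IsPresentable.{v} A) :
    MorphismProperty.HasSmallObjectArgument.{v} S := by
  have (i : S.toSet) : IsPresentable.{v} i.1.left := hS i.1.hom i.2
  obtain ⟨κ, _, -, hκ⟩ := exists_regular_cardinal_isCardinalPresentable
    (fun i : S.toSet ↦ i.1.left) 0
  have : Nonempty κ.ord.ToType := by simpa using (Fact.out : κ.IsRegular).ne_zero
  have := WellFoundedLT.toOrderBot κ.ord.ToType
  refine ⟨κ, inferInstance, inferInstance, { preservesColimit {A B X Y} i hi f hf := ?_ }⟩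
  have : IsCardinalPresentable A κ := hκ ⟨Arrow.mk i, hi⟩
  have := preservesColimitsOfShape_of_isCardinalPresentable A κ κ.ord.ToType
  infer_instance

lemma isCardinalPresentable_of_exists {C : Type u} [Category.{v} C] (X : C)
    (κ : Cardinal.{v}) [Fact κ.IsRegular]
    (h : ∀ (J : Type v) [SmallCategory J] [IsCardinalFiltered J κ] (F : J ⥤ C) (c : Cocone F)
      (_ : IsColimit c),
      (∀ f : X ⟶ c.pt, ∃ (j : J) (g : X ⟶ F.obj j), g ≫ c.ι.app j = f) ∧
      (∀ (j : J) (g g' : X ⟶ F.obj j), g ≫ c.ι.app j = g' ≫ c.ι.app j →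
        ∃ (k : J) (a : j ⟶ k), g ≫ F.map a = g' ≫ F.map a)) :
    IsCardinalPresentable X κ where
  preservesColimitOfShape J _ _ := ⟨fun {F} ↦ ⟨fun {c} hc ↦ by
    have := isFiltered_of_isCardinalFiltered J κ
    obtain ⟨h₁, h₂⟩ := h J F c hc
    refine ⟨Types.FilteredColimit.isColimitOf' _ _ (fun f ↦ ?_) (fun j g g' hgg' ↦ ?_)⟩
    · obtain ⟨j, g, hg⟩ := h₁ f
      exact ⟨j, g, hg.symm⟩
    · obtain ⟨k, a, ha⟩ := h₂ j g g' hgg'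
      exact ⟨k, a, ha⟩⟩⟩

/-- The forgetful functor preserves colimits, and a factorization in `C` through a stage is
automatically over `A`, since the structure map of the stage factors through the colimit. -/
instance isCardinalPresentable_over {C : Type u} [Category.{v} C] [HasColimitsOfSize.{v, v} C]
    {A : C} (X : Over A) (κ : Cardinal.{v}) [Fact κ.IsRegular]
    [IsCardinalPresentable X.left κ] : IsCardinalPresentable X κ := by
  refine isCardinalPresentable_of_exists _ _ (fun J _ _ F c hc ↦ ?_)
  have hc' := isColimitOfPreserves (Over.forget A) hc
  refine ⟨fun f ↦ ?_, fun j g g' hgg' ↦ ?_⟩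
  · obtain ⟨j, g, hg⟩ := IsCardinalPresentable.exists_hom_of_isColimit κ hc' f.left
    dsimp at g hg
    refine ⟨j, Over.homMk g ?_, ?_⟩
    · rw [← Over.w f, ← hg, ← Over.w (c.ι.app j), Category.assoc]
      rfl
    · ext
      exact hg
  · obtain ⟨k, a, ha⟩ := IsCardinalPresentable.exists_eq_of_isColimit' κ hc' (i := j)
      g.left g'.left (congr_arg Over.Hom.left hgg')
    refine ⟨k, a, ?_⟩
    ext
    exact ha

instance isCardinalPresentable_arrow {C : Type u} [Category.{v} C] [HasColimitsOfSize.{v, v} C]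
    (X : Arrow C) (κ : Cardinal.{v}) [Fact κ.IsRegular]
    [IsCardinalPresentable X.left κ] [IsCardinalPresentable X.right κ] :
    IsCardinalPresentable X κ := by
  refine isCardinalPresentable_of_exists _ _ (fun J _ _ F c hc ↦ ?_)
  have := isFiltered_of_isCardinalFiltered J κ
  have hcl := isColimitOfPreserves Arrow.leftFunc hc
  have hcr := isColimitOfPreserves Arrow.rightFunc hc
  refine ⟨fun f ↦ ?_, fun j g g' hgg' ↦ ?_⟩
  · obtain ⟨j₁, (g₁ : X.left ⟶ (F.obj j₁).left), (hg₁ : g₁ ≫ (c.ι.app j₁).left = f.left)⟩ :=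
      IsCardinalPresentable.exists_hom_of_isColimit κ hcl f.left
    obtain ⟨j₂, (g₂ : X.right ⟶ (F.obj j₂).right), (hg₂ : g₂ ≫ (c.ι.app j₂).right = f.right)⟩ :=
      IsCardinalPresentable.exists_hom_of_isColimit κ hcr f.right
    have h₀ : (g₁ ≫ (F.obj j₁).hom) ≫ (c.ι.app j₁).right =
        (X.hom ≫ g₂) ≫ (c.ι.app j₂).right := by
      have h₁ := Arrow.w (c.ι.app j₁)
      have h₂ := Arrow.w f
      dsimp at h₁ h₂
      rw [Category.assoc, Category.assoc, hg₂, ← h₁, reassoc_of% hg₁, h₂]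
    obtain ⟨k, a, b, (hab : (g₁ ≫ (F.obj j₁).hom) ≫ (F.map a).right =
      (X.hom ≫ g₂) ≫ (F.map b).right)⟩ := IsCardinalPresentable.exists_eq_of_isColimit κ hcr
        (i₁ := j₁) (i₂ := j₂) (g₁ ≫ (F.obj j₁).hom) (X.hom ≫ g₂) h₀
    refine ⟨k, Arrow.homMk (g₁ ≫ (F.map a).left) (g₂ ≫ (F.map b).right) ?_, ?_⟩
    · simp only [Category.assoc] at hab
      simp [hab]
    · have h₁ : (F.map a).left ≫ (c.ι.app k).left = (c.ι.app j₁).left :=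
        congr_arg Arrow.Hom.left (c.w a)
      have h₂ : (F.map b).right ≫ (c.ι.app k).right = (c.ι.app j₂).right :=
        congr_arg Arrow.Hom.right (c.w b)
      ext
      · simp [h₁, hg₁]
      · simp [h₂, hg₂]
  · obtain ⟨k₁, a₁, (ha₁ : g.left ≫ (F.map a₁).left = g'.left ≫ (F.map a₁).left)⟩ :=
      IsCardinalPresentable.exists_eq_of_isColimit' κ hcl (i := j)
        g.left g'.left (congr_arg Arrow.Hom.left hgg')
    obtain ⟨k₂, a₂, (ha₂ : g.right ≫ (F.map a₂).right = g'.right ≫ (F.map a₂).right)⟩ :=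
      IsCardinalPresentable.exists_eq_of_isColimit' κ hcr (i := j)
        g.right g'.right (congr_arg Arrow.Hom.right hgg')
    obtain ⟨l, b₁, b₂, hb⟩ := IsFiltered.span a₁ a₂
    refine ⟨l, a₁ ≫ b₁, ?_⟩
    ext
    · simp [reassoc_of% ha₁]
    · simp [hb, reassoc_of% ha₂]

end Presentability

/-! ### Local presentability of slices and arrow categories; completeness -/

section LocallyPresentable

/-- The generators are all maps `G ⟶ A` with `G` a generator of `C`: a test map `G ⟶ X.left` lives
over `A` once `G` gets the composite structure map. -/
instance isCardinalLocallyPresentable_over {C : Type u} [Category.{v} C] (κ : Cardinal.{v})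
    [Fact κ.IsRegular] [IsCardinalLocallyPresentable C κ] (A : C) :
    IsCardinalLocallyPresentable (Over A) κ := by
  obtain ⟨P, _, hP, hP'⟩ :=
    (IsCardinalLocallyPresentable.iff_exists_isStrongGenerator C κ).1 inferInstance
  rw [IsCardinalLocallyPresentable.iff_exists_isStrongGenerator]
  refine ⟨.ofObj (fun (x : Σ X : Subtype P, X.1 ⟶ A) ↦ Over.mk x.2), inferInstance, ?_, ?_⟩
  · rw [ObjectProperty.isStrongGenerator_iff] at hP ⊢
    obtain ⟨h₁, h₂⟩ := hP
    refine ⟨fun X Y f g hfg ↦ ?_, fun X Y i _ hi ↦ ?_⟩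
    · ext
      refine h₁ _ _ (fun G hG h ↦ ?_)
      exact congr_arg Over.Hom.left
        (hfg _ (ObjectProperty.ofObj_apply _ ⟨⟨G, hG⟩, h ≫ X.hom⟩) (Over.homMk (U := Over.mk (h ≫ X.hom)) h))
    · have := h₂ i.left (fun G hG h ↦ by
        obtain ⟨l, hl⟩ := hi _ (ObjectProperty.ofObj_apply _ ⟨⟨G, hG⟩, h ≫ Y.hom⟩) (Over.homMk (U := Over.mk (h ≫ Y.hom)) h)
        exact ⟨l.left, congr_arg Over.Hom.left hl⟩)
      have : IsIso ((Over.forget A).map i) := this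
      exact isIso_of_reflects_iso i (Over.forget A)
  · rintro _ ⟨⟨X, f⟩⟩
    have : IsCardinalPresentable (Over.mk f).left κ := hP' _ X.2
    exact isCardinalPresentable_over (Over.mk f) κ

instance isLocallyPresentable_over {C : Type u} [Category.{v} C]
    [IsLocallyPresentable.{v} C] (A : C) : IsLocallyPresentable.{v} (Over A) := by
  obtain ⟨κ, _, _⟩ := IsLocallyPresentable.exists_cardinal.{v} C
  exact ⟨κ, inferInstance, inferInstance⟩

/-- Maps out of `𝟙 G` see the source of an arrow and maps out of `⊥_ C ⟶ G` see its target, so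
together they generate strongly. -/
instance isCardinalLocallyPresentable_arrow {C : Type u} [Category.{v} C] (κ : Cardinal.{v})
    [Fact κ.IsRegular] [IsCardinalLocallyPresentable C κ] :
    IsCardinalLocallyPresentable (Arrow C) κ := by
  obtain ⟨P, _, hP, hP'⟩ :=
    (IsCardinalLocallyPresentable.iff_exists_isStrongGenerator C κ).1 inferInstance
  rw [IsCardinalLocallyPresentable.iff_exists_isStrongGenerator]
  have hbot : IsCardinalPresentable (⊥_ C) κ := by
    have := isClosedUnderColimitsOfShape_isCardinalPresentable C (κ := κ) (J := Discrete.{0} PEmpty) (by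
      refine .of_le ?_ (Cardinal.IsRegular.aleph0_le Fact.out)
      simp only [hasCardinalLT_aleph0_iff]
      infer_instance)
    exact ObjectProperty.prop_colimit (isCardinalPresentable C κ) (Functor.empty.{0} C) (by rintro ⟨⟨⟩⟩)
  let s : Subtype P ⊕ Subtype P → Arrow C := Sum.elim (fun X ↦ Arrow.mk (𝟙 X.1))
    (fun X ↦ Arrow.mk (initial.to X.1))
  have hs₁ (G : C) (hG : P G) : ObjectProperty.ofObj s (Arrow.mk (𝟙 G)) :=
    ObjectProperty.ofObj_apply s (Sum.inl ⟨G, hG⟩)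
  have hs₂ (G : C) (hG : P G) : ObjectProperty.ofObj s (Arrow.mk (initial.to G)) :=
    ObjectProperty.ofObj_apply s (Sum.inr ⟨G, hG⟩)
  refine ⟨.ofObj s, inferInstance, ?_, ?_⟩
  · rw [ObjectProperty.isStrongGenerator_iff] at hP ⊢
    obtain ⟨h₁, h₂⟩ := hP
    refine ⟨fun X Y f g hfg ↦ ?_, fun X Y i _ hi ↦ ?_⟩
    · ext
      · refine h₁ _ _ (fun G hG h ↦ ?_)
        exact congr_arg Arrow.Hom.left
          (hfg _ (hs₁ G hG) (Arrow.homMk (f := Arrow.mk (𝟙 G)) h (h ≫ X.hom)))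
      · refine h₁ _ _ (fun G hG h ↦ ?_)
        exact congr_arg Arrow.Hom.right
          (hfg _ (hs₂ G hG) (Arrow.homMk (f := Arrow.mk (initial.to G)) (initial.to _) h))
    · have hl : Mono i.left := by
        refine ⟨fun {Z} a b hab ↦ ?_⟩
        have := (cancel_mono i).1 (show (Arrow.homMk a (a ≫ X.hom) : Arrow.mk (𝟙 Z) ⟶ X) ≫ i =
          Arrow.homMk b (b ≫ X.hom) ≫ i by
            ext
            · exact hab
            · have : i.left ≫ Y.hom = X.hom ≫ i.right := Arrow.w i
              change (a ≫ X.hom) ≫ i.right = (b ≫ X.hom) ≫ i.right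
              rw [Category.assoc, Category.assoc, ← this, reassoc_of% hab])
        exact congr_arg Arrow.Hom.left this
      have hr : Mono i.right := by
        refine ⟨fun {Z} a b hab ↦ ?_⟩
        have := (cancel_mono i).1 (show
          (Arrow.homMk (initial.to _) a : Arrow.mk (initial.to Z) ⟶ X) ≫ i =
          Arrow.homMk (initial.to _) b ≫ i by
            ext
            · simp
            · exact hab)
        exact congr_arg Arrow.Hom.right this
      have := h₂ i.left (fun G hG h ↦ by
        obtain ⟨l, hl⟩ := hi _ (hs₁ G hG)
          (Arrow.homMk (f := Arrow.mk (𝟙 G)) h (h ≫ Y.hom))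
        exact ⟨l.left, congr_arg Arrow.Hom.left hl⟩)
      have := h₂ i.right (fun G hG h ↦ by
        obtain ⟨l, hl⟩ := hi _ (hs₂ G hG)
          (Arrow.homMk (f := Arrow.mk (initial.to G)) (initial.to _) h)
        exact ⟨l.right, congr_arg Arrow.Hom.right hl⟩)
      exact Arrow.isIso_of_isIso_left_of_isIso_right i
  · rintro _ ⟨X | X⟩
    · have : IsCardinalPresentable X.1 κ := hP' _ X.2
      have h₁ : IsCardinalPresentable (Arrow.mk (𝟙 X.1)).left κ := this
      have h₂ : IsCardinalPresentable (Arrow.mk (𝟙 X.1)).right κ := this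
      exact isCardinalPresentable_arrow (Arrow.mk (𝟙 X.1)) κ
    · have h₁ : IsCardinalPresentable (Arrow.mk (initial.to X.1)).left κ := hbot
      have h₂ : IsCardinalPresentable (Arrow.mk (initial.to X.1)).right κ := hP' _ X.2
      exact isCardinalPresentable_arrow (Arrow.mk (initial.to X.1)) κ

/-- Locally presentable categories are complete. -/
lemma hasLimitsOfSize_of_isLocallyPresentable (C : Type u) [Category.{v} C]
    [IsLocallyPresentable.{v} C] : HasLimitsOfSize.{v, v} C := by
  obtain ⟨κ, _, _⟩ := IsLocallyPresentable.exists_cardinal.{v} C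
  let e := equivSmallModel.{v} (isCardinalPresentable C κ).FullSubcategory
  let F : SmallModel.{v} (isCardinalPresentable C κ).FullSubcategory ⥤ C :=
    e.inverse ⋙ (isCardinalPresentable C κ).ι
  have : F.IsDense := inferInstance
  -- By density `C` is a reflective subcategory of presheaves on a small category, and so inherits
  -- limits.
  let _ : Reflective (Presheaf.restrictedULiftYoneda.{v} F) :=
    { L := uliftYoneda.{v}.leftKanExtension F
      adj := Presheaf.uliftYonedaAdjunction.{v} _ (uliftYoneda.{v}.leftKanExtensionUnit F) }
  constructor
  intro J _
  exact hasLimitsOfShape_of_reflective (Presheaf.restrictedULiftYoneda.{v} F)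

end LocallyPresentable

end DirectedCylinder

/-! ### Directed homotopies, weak equivalences and trivial cofibrations -/

namespace DirectedCylinder

variable {D : Type u} [Category.{v} D]

/-- A cylinder functor with ends `e` and `d`, satisfying the lifting properties with respect to
"naive fibrations" (the morphisms in `An.rlp`) of a cylinder for which `An` is a class of anodyne
extensions directed by the end `d`. -/
structure DirectedHomotopy (L An : MorphismProperty D) where
  /-- the cylinder functor -/
  I : D ⥤ D
  /-- the free end -/
  e : 𝟭 D ⟶ I
  /-- the directing end -/
  d : 𝟭 D ⟶ I
  /-- the projection -/
  σ : I ⟶ 𝟭 D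
  e_σ (X : D) : e.app X ≫ σ.app X = 𝟙 X
  d_σ (X : D) : d.app X ≫ σ.app X = 𝟙 X
  homotopy_lift_of_rlp {X E B : D} (p : E ⟶ B) (hp : L.rlp p) (a₀ a₁ : X ⟶ E) (b : I.obj X ⟶ B)
    (h₀ : e.app X ≫ b = a₀ ≫ p) (h₁ : d.app X ≫ b = a₁ ≫ p) :
    ∃ h : I.obj X ⟶ E, e.app X ≫ h = a₀ ∧ d.app X ≫ h = a₁ ∧ h ≫ p = b
  homotopy_extension {K M E B : D} (j : K ⟶ M) (hj : L j) (p : E ⟶ B) (hp : An.rlp p)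
    (a : M ⟶ E) (h : I.obj K ⟶ E) (b : I.obj M ⟶ B) (h₁ : d.app K ≫ h = j ≫ a)
    (h₂ : d.app M ≫ b = a ≫ p) (h₃ : I.map j ≫ b = h ≫ p) :
    ∃ k : I.obj M ⟶ E, d.app M ≫ k = a ∧ I.map j ≫ k = h ∧ k ≫ p = b
  homotopy_lift {X E B : D} (p : E ⟶ B) (hp : An.rlp p) (a : X ⟶ E) (b : I.obj X ⟶ B)
    (h : d.app X ≫ b = a ≫ p) : ∃ k : I.obj X ⟶ E, d.app X ≫ k = a ∧ k ≫ p = b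
  square_lift {X E B : D} (p : E ⟶ B) (hp : An.rlp p) (l₀ l₁ m : I.obj X ⟶ E)
    (β : I.obj (I.obj X) ⟶ B) (h₀ : d.app X ≫ l₀ = e.app X ≫ m) (h₁ : d.app X ≫ l₁ = d.app X ≫ m)
    (hβ₀ : I.map (e.app X) ≫ β = l₀ ≫ p) (hβ₁ : I.map (d.app X) ≫ β = l₁ ≫ p)
    (hβ : d.app (I.obj X) ≫ β = m ≫ p) :
    ∃ n : I.obj X ⟶ E, e.app X ≫ n = e.app X ≫ l₀ ∧ d.app X ≫ n = e.app X ≫ l₁ ∧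
      n ≫ p = e.app (I.obj X) ≫ β
  homotopy_extension_of_anodyne {K M E B : D} (j : K ⟶ M) (hj : An j) (p : E ⟶ B)
    (hp : An.rlp p) (a₀ a₁ : M ⟶ E) (h : I.obj K ⟶ E) (b : I.obj M ⟶ B)
    (h₀ : e.app K ≫ h = j ≫ a₀) (h₁ : d.app K ≫ h = j ≫ a₁)
    (hb₀ : e.app M ≫ b = a₀ ≫ p) (hb₁ : d.app M ≫ b = a₁ ≫ p) (hb : I.map j ≫ b = h ≫ p) :
    ∃ k : I.obj M ⟶ E, e.app M ≫ k = a₀ ∧ d.app M ≫ k = a₁ ∧ I.map j ≫ k = h ∧ k ≫ p = b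

/-- An object is `An`-fibrant if its map to the terminal object is a naive fibration. -/
def IsNaiveFibrant [HasTerminal D] (An : MorphismProperty D) (X : D) : Prop :=
  An.rlp (terminal.from X)

lemma isNaiveFibrant_terminal [HasTerminal D] (An : MorphismProperty D) :
    IsNaiveFibrant An (⊤_ D) := by
  rw [IsNaiveFibrant, Subsingleton.elim (terminal.from (⊤_ D)) (𝟙 _)]
  exact MorphismProperty.id_mem _ _

lemma IsNaiveFibrant.of_rlp [HasTerminal D] {An : MorphismProperty D} {E B : D}
    (hB : IsNaiveFibrant An B) (p : E ⟶ B) (hp : An.rlp p) : IsNaiveFibrant An E := by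
  rw [IsNaiveFibrant, Subsingleton.elim (terminal.from E) (p ≫ terminal.from B)]
  exact MorphismProperty.comp_mem _ _ _ hp hB

lemma IsNaiveFibrant.exists_extension [HasTerminal D] {An : MorphismProperty D} {F : D}
    (hF : IsNaiveFibrant An F) {X Y : D} (f : X ⟶ Y) (hf : An f) (u : X ⟶ F) :
    ∃ v : Y ⟶ F, f ≫ v = u := by
  have := hF f hf
  have sq : CommSq u f (terminal.from F) (terminal.from Y) := ⟨Subsingleton.elim _ _⟩
  exact ⟨sq.lift, sq.fac_left⟩

namespace DirectedHomotopy

attribute [simp] e_σ d_σ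

variable {L An : MorphismProperty D} (H : DirectedHomotopy L An)

@[simp]
lemma e_σ_assoc {X Y : D} (f : X ⟶ Y) : H.e.app X ≫ H.σ.app X ≫ f = f := by
  rw [← Category.assoc, e_σ]
  exact Category.id_comp f

@[simp]
lemma d_σ_assoc {X Y : D} (f : X ⟶ Y) : H.d.app X ≫ H.σ.app X ≫ f = f := by
  rw [← Category.assoc, d_σ]
  exact Category.id_comp f

lemma e_naturality_assoc {X Y Z : D} (f : X ⟶ Y) (g : H.I.obj Y ⟶ Z) :
    H.e.app X ≫ H.I.map f ≫ g = f ≫ H.e.app Y ≫ g :=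
  (NatTrans.naturality_assoc H.e f g).symm

lemma d_naturality_assoc {X Y Z : D} (f : X ⟶ Y) (g : H.I.obj Y ⟶ Z) :
    H.d.app X ≫ H.I.map f ≫ g = f ≫ H.d.app Y ≫ g :=
  (NatTrans.naturality_assoc H.d f g).symm

lemma σ_naturality_assoc {X Y Z : D} (f : X ⟶ Y) (g : Y ⟶ Z) :
    H.I.map f ≫ H.σ.app Y ≫ g = H.σ.app X ≫ f ≫ g :=
  NatTrans.naturality_assoc H.σ f g

/-- The homotopy relation defined by the cylinder. -/
def Htpy {X F : D} (f g : X ⟶ F) : Prop :=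
  ∃ h : H.I.obj X ⟶ F, H.e.app X ≫ h = f ∧ H.d.app X ≫ h = g

variable {H}

namespace Htpy

lemma refl {X F : D} (f : X ⟶ F) : H.Htpy f f := ⟨H.σ.app X ≫ f, by simp, by simp⟩

lemma precomp {X Y F : D} {f g : Y ⟶ F} (h : H.Htpy f g) (u : X ⟶ Y) :
    H.Htpy (u ≫ f) (u ≫ g) := by
  obtain ⟨h, rfl, rfl⟩ := h
  exact ⟨H.I.map u ≫ h, H.e_naturality_assoc _ _, H.d_naturality_assoc _ _⟩

lemma postcomp {X F G : D} {f g : X ⟶ F} (h : H.Htpy f g) (u : F ⟶ G) :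
    H.Htpy (f ≫ u) (g ≫ u) := by
  obtain ⟨h, rfl, rfl⟩ := h
  exact ⟨h ≫ u, by simp, by simp⟩

variable [HasTerminal D] {X F : D} (hF : IsNaiveFibrant An F)

-- The missing side of the square lies at the free end. Symmetry and transitivity are the cases
-- where some of the given sides are constant.
include hF in
lemma of_square {f₀ f₁ g₀ g₁ : X ⟶ F} (h₀ : H.Htpy f₀ g₀) (h₁ : H.Htpy f₁ g₁)
    (h : H.Htpy g₀ g₁) : H.Htpy f₀ f₁ := by
  obtain ⟨l₀, rfl, hl₀⟩ := h₀
  obtain ⟨l₁, rfl, hl₁⟩ := h₁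
  obtain ⟨m, hm₀, hm₁⟩ := h
  obtain ⟨n, hn₀, hn₁, -⟩ := H.square_lift _ hF l₀ l₁ m (terminal.from _) (hl₀.trans hm₀.symm)
    (hl₁.trans hm₁.symm) (Subsingleton.elim _ _) (Subsingleton.elim _ _) (Subsingleton.elim _ _)
  exact ⟨n, hn₀, hn₁⟩

include hF in
lemma symm {f g : X ⟶ F} (h : H.Htpy f g) : H.Htpy g f :=
  of_square hF (.refl g) h (.refl g)

include hF in
lemma trans {f g k : X ⟶ F} (h : H.Htpy f g) (h' : H.Htpy g k) : H.Htpy f k :=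
  of_square hF h (h'.symm hF) (.refl g)

end Htpy

variable [HasTerminal D]

variable (H) in
/-- The weak equivalences: the morphisms which induce bijections on homotopy classes of maps
to naively fibrant objects. -/
def W : MorphismProperty D := fun X Y f ↦ ∀ F : D, IsNaiveFibrant An F →
  (∀ u : X ⟶ F, ∃ v : Y ⟶ F, H.Htpy (f ≫ v) u) ∧
  (∀ v v' : Y ⟶ F, H.Htpy (f ≫ v) (f ≫ v') → H.Htpy v v')

namespace W

lemma comp {X Y Z : D} {f : X ⟶ Y} {g : Y ⟶ Z} (hf : H.W f) (hg : H.W g) : H.W (f ≫ g) := by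
  intro F hF
  refine ⟨fun u ↦ ?_, fun v v' h ↦ ?_⟩
  · obtain ⟨v, hv⟩ := (hf F hF).1 u
    obtain ⟨w, hw⟩ := (hg F hF).1 v
    exact ⟨w, by simpa using (hw.precomp f).trans hF hv⟩
  · simp only [Category.assoc] at h
    exact (hg F hF).2 _ _ ((hf F hF).2 _ _ h)

lemma of_precomp {X Y Z : D} {f : X ⟶ Y} {g : Y ⟶ Z} (hf : H.W f) (hfg : H.W (f ≫ g)) :
    H.W g := by
  intro F hF
  refine ⟨fun v ↦ ?_, fun w w' h ↦ ?_⟩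
  · obtain ⟨w, hw⟩ := (hfg F hF).1 (f ≫ v)
    exact ⟨w, (hf F hF).2 _ _ (by simpa using hw)⟩
  · exact (hfg F hF).2 _ _ (by simpa using h.precomp f)

lemma of_postcomp {X Y Z : D} {f : X ⟶ Y} {g : Y ⟶ Z} (hg : H.W g) (hfg : H.W (f ≫ g)) :
    H.W f := by
  intro F hF
  refine ⟨fun u ↦ ?_, fun v v' h ↦ ?_⟩
  · obtain ⟨w, hw⟩ := (hfg F hF).1 u
    exact ⟨g ≫ w, by simpa using hw⟩
  · obtain ⟨w, hw⟩ := (hg F hF).1 v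
    obtain ⟨w', hw'⟩ := (hg F hF).1 v'
    have := (hfg F hF).2 w w' (by
      simpa using ((hw.precomp f).trans hF h).trans hF ((hw'.precomp f).symm hF))
    exact ((hw.symm hF).trans hF (this.precomp g)).trans hF hw'

/-- On homotopy classes, precomposition with `t` is surjective because of `t ≫ p` and injective
because of `f ≫ t`; two-out-of-three then gives `f`. -/
lemma two_out_of_six {X Y Z T : D} {f : X ⟶ Y} {t : Y ⟶ Z} {p : Z ⟶ T} (h₁ : H.W (f ≫ t))
    (h₂ : H.W (t ≫ p)) : H.W f := by
  refine of_postcomp (g := t) (fun F hF ↦ ⟨fun v ↦ ?_, fun w w' h ↦ ?_⟩) h₁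
  · obtain ⟨x, hx⟩ := (h₂ F hF).1 v
    exact ⟨p ≫ x, by simpa using hx⟩
  · exact (h₁ F hF).2 _ _ (by simpa using h.precomp f)

lemma of_anodyne {X Y : D} {f : X ⟶ Y} (hf : An f) : H.W f := by
  intro F hF
  refine ⟨fun u ↦ ?_, fun v v' ⟨h, h₀, h₁⟩ ↦ ?_⟩
  · obtain ⟨v, rfl⟩ := hF.exists_extension f hf u
    exact ⟨v, .refl _⟩
  · obtain ⟨k, hk₀, hk₁, -, -⟩ := H.homotopy_extension_of_anodyne f hf _ hF v v' h
      (terminal.from _) h₀ h₁ (Subsingleton.elim _ _) (Subsingleton.elim _ _)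
      (Subsingleton.elim _ _)
    exact ⟨k, hk₀, hk₁⟩

/-- Cofibrancy of `B` gives a section of `p`; the constant homotopy in `B` lifts with both ends
prescribed, making the section a homotopy inverse. -/
lemma of_rlp [HasInitial D] (hL : ∀ X : D, L (initial.to X)) {E B : D} {p : E ⟶ B}
    (hp : L.rlp p) : H.W p := by
  have := hp _ (hL B)
  have sq : CommSq (initial.to E) (initial.to B) p (𝟙 B) := ⟨Subsingleton.elim _ _⟩
  have hs : sq.lift ≫ p = 𝟙 B := sq.fac_right
  have hps : H.Htpy (p ≫ sq.lift) (𝟙 E) := by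
    obtain ⟨h, h₀, h₁, -⟩ := H.homotopy_lift_of_rlp p hp (p ≫ sq.lift) (𝟙 E) (H.σ.app E ≫ p)
      (by simp [hs]) (by simp)
    exact ⟨h, h₀, h₁⟩
  refine fun F hF ↦ ⟨fun u ↦ ⟨sq.lift ≫ u, by simpa using hps.postcomp u⟩, fun v v' h ↦ ?_⟩
  simpa [reassoc_of% hs] using h.precomp sq.lift

instance : (H.W).HasTwoOutOfThreeProperty where
  comp_mem _ _ hf hg := comp hf hg
  of_postcomp _ _ hg hfg := of_postcomp hg hfg
  of_precomp _ _ hf hfg := of_precomp hf hfg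

lemma of_isIso {X Y : D} (f : X ⟶ Y) [IsIso f] : H.W f := fun F _ ↦
  ⟨fun u ↦ ⟨inv f ≫ u, by simpa using .refl u⟩, fun v v' h ↦ by simpa using h.precomp (inv f)⟩

/-- Naive fibrations between fibrant objects which are weak equivalences are trivial
fibrations. -/
lemma rlp_of_isNaiveFibrant {E B : D} {p : E ⟶ B} (hW : H.W p) (hp : An.rlp p)
    (hB : IsNaiveFibrant An B) : L.rlp p := by
  have hE := hB.of_rlp p hp
  -- A homotopy inverse `s₀` is moved along a lifted homotopy to a strict section `s`.
  obtain ⟨s₀, hs₀⟩ := (hW E hE).1 (𝟙 E)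
  have hs₀' : H.Htpy (𝟙 B) (s₀ ≫ p) := ((hW B hB).2 _ _ (by
    simpa using hs₀.postcomp p)).symm hB
  obtain ⟨k, hk₀, hk₁⟩ := hs₀'
  obtain ⟨k', hk', hk'p⟩ := H.homotopy_lift p hp s₀ k hk₁
  let s := H.e.app B ≫ k'
  have hs : s ≫ p = 𝟙 B := by simp [s, hk'p, hk₀]
  have hss₀ : H.Htpy s s₀ := ⟨k', rfl, hk'⟩
  obtain ⟨h, hh₀, hh₁⟩ : H.Htpy (𝟙 E) (p ≫ s) :=
    (hs₀.symm hE).trans hE ((hss₀.precomp p).symm hE)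
  -- The homotopy `h` may move in the base. Cancelling it against its image `h ≫ p ≫ s` gives `n`,
  -- still from `𝟙 E` to `p ≫ s` but now constant over `B`.
  obtain ⟨n, hn₀, hn₁, hn⟩ := H.square_lift p hp h (h ≫ p ≫ s) (H.σ.app E ≫ p ≫ s)
    (H.I.map (H.σ.app E) ≫ h ≫ p) (by simp [hh₁]) (by simp [reassoc_of% hh₁, reassoc_of% hs])
    (by simp [← Functor.map_comp_assoc]) (by simp [← Functor.map_comp_assoc, hs])
    (by
      have := H.d_naturality_assoc (H.σ.app E) (h ≫ p)
      dsimp at this ⊢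
      simp [this, reassoc_of% hh₁, hs])
  have hn' : n ≫ p = H.σ.app E ≫ p := by
    have := H.e_naturality_assoc (H.σ.app E) (h ≫ p)
    dsimp at this hn
    simp [hn, this, reassoc_of% hh₀]
  rw [hh₀] at hn₀
  rw [reassoc_of% hh₀] at hn₁
  intro K M j hj
  refine ⟨fun {u v} sq ↦ ?_⟩
  have w := sq.w
  -- `v ≫ s` solves the problem up to the homotopy `n` on `K`. Extending that homotopy over `M`,
  -- within the fibres, and taking its free end gives a strict lift.
  obtain ⟨l, hl₁, hl₂, hl₃⟩ := H.homotopy_extension j hj p hp (v ≫ s) (H.I.map u ≫ n)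
    (H.σ.app M ≫ v) (by
      have := H.d_naturality_assoc u n
      dsimp at this ⊢
      rw [this, hn₁, reassoc_of% w]) (by simp [hs]) (by
      have h₁ := H.σ_naturality_assoc j v
      have h₂ := H.σ_naturality_assoc u p
      dsimp at h₁ h₂ ⊢
      rw [Category.assoc, hn', h₁, h₂, w])
  refine ⟨⟨⟨H.e.app M ≫ l, ?_, by simp [hl₃]⟩⟩⟩
  have h₁ := H.e_naturality_assoc j l
  have h₂ := H.e_naturality_assoc u n
  dsimp at h₁ h₂
  rw [← h₁, hl₂, h₂, hn₀, Category.comp_id]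

/-- The anodyne maps `r` and `i` are weak equivalences, so `f` and `p` are weak equivalences
together. This replaces the homotopical condition on `f` by a lifting property of `p`. -/
lemma iff_rlp [HasInitial D] (hL : ∀ X : D, L (initial.to X)) {X Y X' Y' : D} {f : X ⟶ Y}
    {r : Y ⟶ Y'} {i : X ⟶ X'} {p : X' ⟶ Y'} (hr : An r) (hY' : IsNaiveFibrant An Y')
    (hi : An i) (hp : An.rlp p) (fac : i ≫ p = f ≫ r) : H.W f ↔ L.rlp p := by
  refine ⟨fun h ↦ rlp_of_isNaiveFibrant (H := H) ?_ hp hY', fun h ↦ ?_⟩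
  · exact of_precomp (of_anodyne hi) (by rw [fac]; exact comp h (of_anodyne hr))
  · exact of_postcomp (of_anodyne hr) (by rw [← fac]; exact comp (of_anodyne hi) (of_rlp hL h))

end W

/-- Naive fibrations with a fibrant target. -/
def fibrantFibrations (An : MorphismProperty D) : MorphismProperty D := fun _ B p ↦
  An.rlp p ∧ IsNaiveFibrant An B

variable [HasInitial D]

/-- Trivial cofibrations are characterized by a left lifting property. -/
lemma inf_W_eq (hL : ∀ X : D, L (initial.to X)) (hAn : An ≤ L) (hAn' : An.rlp.llp = An)
    (hLR : L.rlp.llp = L)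
    [An.HasFactorization An.rlp] : L ⊓ H.W = (L.rlp ⊔ fibrantFibrations An).llp := by
  ext X Y f
  let r := MorphismProperty.factorizationData An An.rlp (terminal.from Y)
  have hY' : IsNaiveFibrant An r.Z := by
    rw [IsNaiveFibrant, Subsingleton.elim (terminal.from _) r.p]
    exact r.hp
  let φ := MorphismProperty.factorizationData An An.rlp (f ≫ r.i)
  constructor
  · rintro ⟨hf, hW⟩
    have hφ := (W.iff_rlp hL r.hi hY' φ.hi φ.hp φ.fac).1 hW
    -- Retract argument: `φ.p` is a trivial fibration, so `f ≫ r.i` inherits the lifting properties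
    -- of the anodyne `φ.i`.
    have hfr : An (f ≫ r.i) := by
      suffices An.rlp.llp (f ≫ r.i) by rwa [hAn'] at this
      intro E B p hp
      have := hp _ φ.hi
      have hfr : L (f ≫ r.i) := by
        have : L.rlp.llp (f ≫ r.i) :=
          MorphismProperty.comp_mem _ _ _ (by rwa [hLR]) (by rw [hLR]; exact hAn _ r.hi)
        rwa [hLR] at this
      have := hφ _ hfr
      have sq : CommSq φ.i (f ≫ r.i) φ.p (𝟙 _) := ⟨by simp⟩
      refine ⟨fun {u v} sq' ↦ ?_⟩
      have sq'' : CommSq u φ.i p (φ.p ≫ v) := ⟨by simpa using sq'.w⟩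
      exact ⟨⟨⟨sq.lift ≫ sq''.lift, by simp [sq.fac_left_assoc], by simp [sq.fac_right_assoc]⟩⟩⟩
    rintro E B p (hp | ⟨hp, hB⟩)
    · exact hp _ hf
    · have := hp _ hfr
      refine ⟨fun {u v} sq ↦ ?_⟩
      -- Fibrancy of `B` extends the bottom map along `r.i`; one lifts against `f ≫ r.i` and
      -- restricts.
      obtain ⟨v', rfl⟩ := hB.exists_extension _ r.hi v
      have sq' : CommSq u (f ≫ r.i) p v' := ⟨by simpa using sq.w⟩
      exact ⟨⟨⟨r.i ≫ sq'.lift, by rw [← Category.assoc, sq'.fac_left], by simp⟩⟩⟩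
  · intro hf
    refine ⟨?_, ?_⟩
    · rw [← hLR]
      exact fun E B p hp ↦ hf _ (Or.inl hp)
    -- The lift `t` satisfies `f ≫ t = φ.i` and `t ≫ φ.p = r.i`, both anodyne.
    · have := hf φ.p (Or.inr ⟨φ.hp, hY'⟩)
      have sq : CommSq φ.i f φ.p r.i := ⟨φ.fac⟩
      exact W.two_out_of_six (t := sq.lift) (p := φ.p)
        (by rw [sq.fac_left]; exact W.of_anodyne φ.hi)
        (by rw [sq.fac_right]; exact W.of_anodyne r.hi)

end DirectedHomotopy

end DirectedCylinder

/-! ### Filtered colimits and factorizations of diagrams -/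

namespace DirectedCylinder

variable {D : Type u} [Category.{v} D]

section FilteredColimits

variable {J : Type v} [SmallCategory J] (κ : Cardinal.{v}) [Fact κ.IsRegular]
  [IsCardinalFiltered J κ] {U V : J ⥤ D} (q : U ⟶ V)

/-- Lifting properties of filtered colimits of morphisms against presentable morphisms. -/
lemma hasLiftingProperty_colimMap_iff [HasColimit U] [HasColimit V] {A B : D} (i : A ⟶ B)
    [IsCardinalPresentable A κ] [IsCardinalPresentable B κ] :
    HasLiftingProperty i (colimMap q) ↔
      ∀ (j : J) (a : A ⟶ U.obj j) (b : B ⟶ V.obj j), a ≫ q.app j = i ≫ b →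
        ∃ (k : J) (f : j ⟶ k) (l : B ⟶ U.obj k), i ≫ l = a ≫ U.map f ∧
          l ≫ q.app k = b ≫ V.map f := by
  have := isFiltered_of_isCardinalFiltered J κ
  have hU := colimit.isColimit U
  have hV := colimit.isColimit V
  constructor
  · intro h j a b hab
    have sq : CommSq (a ≫ colimit.ι U j) i (colimMap q) (b ≫ colimit.ι V j) :=
      ⟨by simp [reassoc_of% hab]⟩
    obtain ⟨j₁, l, hl⟩ := IsCardinalPresentable.exists_hom_of_isColimit κ hU sq.lift
    dsimp at hl
    obtain ⟨j₂, f₁, f₂, hf⟩ := IsCardinalPresentable.exists_eq_of_isColimit κ hU (i ≫ l) a (by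
      dsimp
      rw [Category.assoc, hl, sq.fac_left])
    obtain ⟨j₃, f₃, hf₃⟩ := IsCardinalPresentable.exists_eq_of_isColimit' κ hV
      (l ≫ q.app j₁ ≫ V.map f₁) (b ≫ V.map f₂) (by
        have := sq.fac_right
        rw [← hl] at this
        simpa using this)
    refine ⟨j₃, f₂ ≫ f₃, l ≫ U.map f₁ ≫ U.map f₃, ?_, ?_⟩
    · simp only [Category.assoc] at hf
      simp [reassoc_of% hf]
    · simpa using hf₃
  · intro h
    refine ⟨fun {a b} sq ↦ ?_⟩
    obtain ⟨j₁, a, rfl⟩ := IsCardinalPresentable.exists_hom_of_isColimit κ hU a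
    obtain ⟨j₂, b, rfl⟩ := IsCardinalPresentable.exists_hom_of_isColimit κ hV b
    obtain ⟨j, f₁, f₂, hf⟩ := IsCardinalPresentable.exists_eq_of_isColimit κ hV
      (a ≫ q.app j₁) (i ≫ b) (by simpa using sq.w)
    obtain ⟨k, f, l, h₁, h₂⟩ := h j (a ≫ U.map f₁) (b ≫ V.map f₂) (by simpa using hf)
    refine ⟨⟨⟨l ≫ colimit.ι U k, ?_, ?_⟩⟩⟩
    · simp [reassoc_of% h₁]
    · simp [reassoc_of% h₂]

end FilteredColimits

section FreeDiagrams

variable (P : Type v) [SmallCategory P] [HasColimitsOfSize.{v, v} D]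

/-- The free `P`-diagrams on the morphisms in a class. -/
def freeDiagrams (S : MorphismProperty D) : MorphismProperty (P ⥤ D) :=
  MorphismProperty.ofHoms (fun (x : P × S.toSet) ↦ (evaluationLeftAdjoint D x.1).map x.2.1.hom)

instance (S : MorphismProperty D) [MorphismProperty.IsSmall.{v} S] :
    MorphismProperty.IsSmall.{v} (freeDiagrams P S) := by
  dsimp [freeDiagrams]
  infer_instance

-- Evaluation at `t` is right adjoint to the free diagram functor at `t`.
variable {P} in
lemma rlp_freeDiagrams_iff (S : MorphismProperty D) {U V : P ⥤ D} (q : U ⟶ V) :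
    (freeDiagrams P S).rlp q ↔ ∀ t, S.rlp (q.app t) := by
  constructor
  · intro h t A B i hi
    exact ((evaluationAdjunctionRight D t).hasLiftingProperty_iff i q).1
      (h _ (MorphismProperty.ofHoms.mk (⟨t, ⟨Arrow.mk i, hi⟩⟩ : P × S.toSet)))
  · rintro h _ _ _ ⟨t, i, hi⟩
    exact ((evaluationAdjunctionRight D t).hasLiftingProperty_iff i.hom q).2 (h t _ hi)

lemma hasSmallObjectArgument_freeDiagrams (S : MorphismProperty D)
    [MorphismProperty.IsSmall.{v} S] (hS : ∀ ⦃A B : D⦄ (i : A ⟶ B), S i → IsPresentable.{v} A) :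
    MorphismProperty.HasSmallObjectArgument.{v} (freeDiagrams P S) := by
  refine hasSmallObjectArgument_of_isPresentable (freeDiagrams P S) ?_
  rintro _ _ _ ⟨t, i, hi⟩
  obtain ⟨κ, _, hκ⟩ := (hS i.hom hi).exists_cardinal
  have : IsCardinalPresentable i.left κ := hκ
  have := (evaluationAdjunctionRight D t).isCardinalPresentable_leftAdjoint_obj κ i.left
  exact isPresentable_of_isCardinalPresentable _ κ

section

variable {P} (t : P)

/-- The inclusions in the free diagram on an object. -/
noncomputable def freeι (A : D) {s : P} (g : t ⟶ s) :
    A ⟶ ((evaluationLeftAdjoint D t).obj A).obj s :=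
  Sigma.ι (fun _ : t ⟶ s ↦ A) g

lemma freeι_map_assoc (A : D) {s s' : P} (g : t ⟶ s) (f : s ⟶ s') {Z : D}
    (h : ((evaluationLeftAdjoint D t).obj A).obj s' ⟶ Z) :
    freeι t A g ≫ ((evaluationLeftAdjoint D t).obj A).map f ≫ h = freeι t A (g ≫ f) ≫ h :=
  Sigma.ι_desc_assoc _ _ _

lemma freeι_app_assoc {A B : D} (i : A ⟶ B) {s : P} (g : t ⟶ s) {Z : D}
    (h : ((evaluationLeftAdjoint D t).obj B).obj s ⟶ Z) :
    freeι t A g ≫ ((evaluationLeftAdjoint D t).map i).app s ≫ h = i ≫ freeι t B g ≫ h := by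
  refine Eq.trans ?_ (Category.assoc _ _ _)
  exact Sigma.ι_desc_assoc _ _ _

variable {t}

/-- Morphisms from an object of a free diagram. -/
noncomputable def freeDesc {A : D} {s : P} {Z : D} (φ : ∀ (_ : t ⟶ s), A ⟶ Z) :
    ((evaluationLeftAdjoint D t).obj A).obj s ⟶ Z :=
  Sigma.desc φ

@[simp]
lemma freeι_desc {A : D} {s : P} {Z : D} (φ : ∀ (_ : t ⟶ s), A ⟶ Z) (g : t ⟶ s) :
    freeι t A g ≫ freeDesc φ = φ g :=
  Sigma.ι_desc _ _

@[simp]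
lemma freeι_desc_assoc {A : D} {s : P} {Z Z' : D} (φ : ∀ (_ : t ⟶ s), A ⟶ Z) (g : t ⟶ s)
    (h : Z ⟶ Z') : freeι t A g ≫ freeDesc φ ≫ h = φ g ≫ h :=
  Sigma.ι_desc_assoc _ _ _

lemma free_hom_ext {A : D} {s : P} {Z : D}
    {f g : ((evaluationLeftAdjoint D t).obj A).obj s ⟶ Z}
    (h : ∀ k : t ⟶ s, freeι t A k ≫ f = freeι t A k ≫ g) : f = g :=
  Sigma.hom_ext _ _ h

end

/-- The colimit of a restriction of the free diagrams on a morphism has the left lifting property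
with respect to all the morphisms that the given morphism lifts against. -/
lemma hasLiftingProperty_colimMap_free {J : Type v} [SmallCategory J] (τ : J ⥤ P) (t : P)
    {A B E F : D} (i : A ⟶ B) (p : E ⟶ F) [HasLiftingProperty i p] :
    HasLiftingProperty
      (colimMap (Functor.whiskerLeft τ ((evaluationLeftAdjoint D t).map i))) p := by
  refine ⟨fun {a b} sq ↦ ?_⟩
  have w := sq.w
  let a' (j : J) (g : t ⟶ τ.obj j) : A ⟶ E :=
    freeι t A g ≫ colimit.ι (τ ⋙ (evaluationLeftAdjoint D t).obj A) j ≫ a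
  let b' (j : J) (g : t ⟶ τ.obj j) : B ⟶ F :=
    freeι t B g ≫ colimit.ι (τ ⋙ (evaluationLeftAdjoint D t).obj B) j ≫ b
  have sq' (j : J) (g : t ⟶ τ.obj j) : CommSq (a' j g) i p (b' j g) := ⟨by
    have := freeι_app_assoc t i g (colimit.ι (τ ⋙ (evaluationLeftAdjoint D t).obj B) j ≫ b)
    dsimp only [a', b']
    rw [← this]
    erw [Category.assoc, Category.assoc]
    rw [w, ι_colimMap_assoc]
    rfl⟩
  have ha (j k : J) (f : j ⟶ k) (g : t ⟶ τ.obj j) : a' k (g ≫ τ.map f) = a' j g := by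
    dsimp only [a']
    rw [← colimit.w_assoc (τ ⋙ (evaluationLeftAdjoint D t).obj A) f]
    exact (freeι_map_assoc t A g (τ.map f) _).symm
  have hb (j k : J) (f : j ⟶ k) (g : t ⟶ τ.obj j) : b' k (g ≫ τ.map f) = b' j g := by
    dsimp only [b']
    rw [← colimit.w_assoc (τ ⋙ (evaluationLeftAdjoint D t).obj B) f]
    exact (freeι_map_assoc t B g (τ.map f) _).symm
  -- The two squares coincide, hence so do their chosen lifts; this is the compatibility needed to
  -- descend to the colimit.
  have hl (j k : J) (f : j ⟶ k) (g : t ⟶ τ.obj j) :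
      (sq' k (g ≫ τ.map f)).lift = (sq' j g).lift := by
    have h₁ := ha j k f g
    have h₂ := hb j k f g
    congr 1
  let l : colimit (τ ⋙ (evaluationLeftAdjoint D t).obj B) ⟶ E :=
    colimit.desc (τ ⋙ (evaluationLeftAdjoint D t).obj B) (Cocone.mk E
    { app j := freeDesc (fun g ↦ (sq' j g).lift)
      naturality j k f := by
        refine free_hom_ext (fun g ↦ ?_)
        have := freeι_map_assoc t B g (τ.map f) (freeDesc (fun g ↦ (sq' k g).lift))
        dsimp at this ⊢
        rw [this, freeι_desc, hl, Category.comp_id, freeι_desc] })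
  have hl' (j : J) : colimit.ι (τ ⋙ (evaluationLeftAdjoint D t).obj B) j ≫ l =
    freeDesc (fun g ↦ (sq' j g).lift) := colimit.ι_desc _ _
  refine ⟨⟨⟨l, ?_, ?_⟩⟩⟩
  · refine colimit.hom_ext (fun j ↦ free_hom_ext (fun g ↦ ?_))
    rw [ι_colimMap_assoc, hl']
    refine (freeι_app_assoc t i g _).trans ?_
    rw [freeι_desc]
    exact (sq' j g).fac_left
  · refine colimit.hom_ext (fun j ↦ free_hom_ext (fun g ↦ ?_))
    rw [reassoc_of% hl', freeι_desc_assoc]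
    exact (sq' j g).fac_right

/-- Restriction along `τ` followed by colimit has a right adjoint (constant diagram, then right Kan
extension), so only free diagrams need testing. Thus the left factors of diagram factorizations stay
in the left class after restriction and colimit. -/
lemma llp_rlp_colimMap [HasLimitsOfSize.{v, v} D] (S : MorphismProperty D) {J : Type v}
    [SmallCategory J] (τ : J ⥤ P) {U V : P ⥤ D} (q : U ⟶ V)
    (hq : (freeDiagrams P S).rlp.llp q) :
    S.rlp.llp (colimMap (Functor.whiskerLeft τ q)) := by
  intro E F p hp
  let adj : (Functor.whiskeringLeft J P D).obj τ ⋙ colim ⊣ Functor.const J ⋙ τ.ran :=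
    (τ.ranAdjunction D).comp colimConstAdj
  refine (adj.hasLiftingProperty_iff q p).2 (hq _ ?_)
  rintro _ _ _ ⟨t, i, hi⟩
  have := hp i.hom hi
  exact (adj.hasLiftingProperty_iff _ p).1 (hasLiftingProperty_colimMap_free P τ t i.hom p)

end FreeDiagrams

section

variable [HasColimitsOfSize.{v, v} D]

/-- Colimits of arrows are computed componentwise. -/
noncomputable def arrowIsoOfIsColimit {J : Type v} [SmallCategory J] {F : J ⥤ Arrow D}
    {c : Cocone F} (hc : IsColimit c) :
    Arrow.mk (colimMap (Functor.whiskerLeft F Arrow.leftToRight)) ≅ c.pt :=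
  have h₁ := isColimitOfPreserves Arrow.leftFunc hc
  have h₂ := isColimitOfPreserves Arrow.rightFunc hc
  Arrow.isoMk ((colimit.isColimit _).coconePointUniqueUpToIso h₁)
    ((colimit.isColimit _).coconePointUniqueUpToIso h₂) (by
      refine colimit.hom_ext (fun j ↦ ?_)
      dsimp
      rw [ι_colimMap_assoc]
      have e₁ := IsColimit.comp_coconePointUniqueUpToIso_hom
        (colimit.isColimit (F ⋙ Arrow.leftFunc)) h₁ j
      have e₂ := IsColimit.comp_coconePointUniqueUpToIso_hom
        (colimit.isColimit (F ⋙ Arrow.rightFunc)) h₂ j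
      have e₃ : (c.ι.app j).left ≫ c.pt.hom = (F.obj j).hom ≫ (c.ι.app j).right :=
        Arrow.w (c.ι.app j)
      refine (Category.assoc _ _ _).symm.trans ?_
      refine (congr_arg (· ≫ c.pt.hom) e₁).trans ?_
      exact e₃.trans (congr_arg ((F.obj j).hom ≫ ·) e₂.symm))

end

end DirectedCylinder

/-! ### Löwenheim-Skolem argument for directed diagrams -/

namespace DirectedCylinder

section LowenheimSkolem

variable (κ : Cardinal.{v}) (Q : Type v)

/-- Terms generated by a constant, unary operations indexed by `Q`, and formal upper bounds of
families of cardinality `< κ`. -/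
inductive DirectedTerm : Type v
  | base : DirectedTerm
  | sol (x : DirectedTerm) (q : Q) : DirectedTerm
  | bound (s : {s : Set κ.ord.ToType // Cardinal.mk s < κ}) (f : s.1 → DirectedTerm) : DirectedTerm

variable {κ} [Fact κ.IsRegular] {P : Type v} [SmallCategory P] (Prob : P → Type v)
  (Sol : ∀ (s t : P), Prob s → (s ⟶ t) → Prop)

/-- A diagram is saturated if all the problems that are posed in the diagram have a solution
at a later stage. -/
def IsSaturated {J : Type v} [SmallCategory J] (τ : J ⥤ P) : Prop :=
  ∀ (j : J) (x : Prob (τ.obj j)), ∃ (k : J) (f : j ⟶ k), Sol _ _ x (τ.map f)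

variable {Prob Sol}

/-- The downward Löwenheim-Skolem theorem for saturated directed diagrams. -/
lemma IsSaturated.exists_directedTerm {α : Type v} [PartialOrder α] [IsCardinalFiltered α κ]
    {τ : α ⥤ P} (hτ : IsSaturated Prob Sol τ) (a : α) :
    ∃ (_ : Preorder (DirectedTerm κ (Σ t, Prob t))) (F : DirectedTerm κ (Σ t, Prob t) ⥤ α),
      IsCardinalFiltered (DirectedTerm κ (Σ t, Prob t)) κ ∧ IsSaturated Prob Sol (F ⋙ τ) ∧
      F.obj .base = a := by
  choose k f hf using hτ
  have hs (s : {s : Set κ.ord.ToType // Cardinal.mk s < κ}) (g : s.1 → α) :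
      ∃ b, ∀ i, g i ≤ b :=
    have hs : HasCardinalLT s.1 κ := by simpa [hasCardinalLT_iff_cardinal_mk_lt] using s.2
    ⟨IsCardinalFiltered.max g hs, fun i ↦ leOfHom (IsCardinalFiltered.toMax g hs i)⟩
  choose b hb using hs
  -- A problem `q` acts only at stages lying over its index; elsewhere the default is to stay put.
  let next (x : α) (q : Σ t, Prob t) : α :=
    open Classical in if h : q.1 = τ.obj x then k x (h ▸ q.2) else x
  let ev (x : DirectedTerm κ (Σ t, Prob t)) : α := DirectedTerm.rec a (fun _ q y ↦ next y q)
    (fun s _ g ↦ b s g) x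
  -- Only the order on terms depends on `α`, by comparison of values; the type of terms does not,
  -- which makes the bound uniform.
  let : Preorder (DirectedTerm κ (Σ t, Prob t)) := Preorder.lift ev
  have hev : Monotone ev := fun _ _ h ↦ h
  refine ⟨inferInstance, hev.functor, isCardinalFiltered_preorder _ _ (fun K s hK ↦ ?_),
    fun x (q : Prob (τ.obj (ev x))) ↦ ?_, rfl⟩
  -- Formal bounds are indexed by subsets of `κ.ord.ToType`, so `K` is first embedded there.
  · have : Cardinal.mk K ≤ Cardinal.mk κ.ord.ToType := by simpa using hK.le
    obtain ⟨ψ⟩ := this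
    refine ⟨.bound ⟨Set.range ψ, by rwa [Cardinal.mk_range_eq _ ψ.injective]⟩
      (fun x ↦ s ((Equiv.ofInjective _ ψ.injective).symm x)), fun i ↦ ?_⟩
    have := hb ⟨Set.range ψ, by rwa [Cardinal.mk_range_eq _ ψ.injective]⟩
      (fun x ↦ ev (s ((Equiv.ofInjective _ ψ.injective).symm x))) ⟨ψ i, i, rfl⟩
    dsimp at this
    rw [Equiv.ofInjective_symm_apply] at this
    exact this
  · have h : k (ev x) q = ev (.sol x ⟨_, q⟩) := by
      change _ = next (ev x) ⟨τ.obj (ev x), q⟩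
      simp [next]
    have hx : x ≤ .sol x ⟨_, q⟩ := by
      change ev x ≤ ev (.sol x ⟨_, q⟩)
      rw [← h]
      exact leOfHom (f (ev x) q)
    refine ⟨.sol x ⟨_, q⟩, homOfLE hx, ?_⟩
    have key : ∀ (y : α) (hy : k (ev x) q = y) (g : ev x ⟶ y), Sol _ _ q (τ.map g) := by
      rintro _ rfl g
      have hg : g = f (ev x) q := ULift.ext _ _ (PLift.down_injective rfl)
      rw [hg]
      exact hf (ev x) q
    exact key _ h _

end LowenheimSkolem

/-! ### The solution set condition -/

variable {D : Type u} [Category.{v} D]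

section

variable {L An : MorphismProperty D} (H : DirectedHomotopy L An) [HasTerminal D]

instance : (H.W).RespectsIso :=
  MorphismProperty.respectsIso_of_isStableUnderComposition (fun _ _ f (_ : IsIso f) ↦ .of_isIso f)

end

variable [IsLocallyPresentable.{v} D] [HasTerminal D] [HasInitial D]
  {L An : MorphismProperty D} (H : DirectedHomotopy L An) (S Λ : MorphismProperty D)
  [MorphismProperty.IsSmall.{v} S] [MorphismProperty.IsSmall.{v} Λ]

/-- The condition that a filtered colimit of morphisms is a weak equivalence can be expressed
in terms of the existence of solutions of certain problems. -/
lemma exists_saturated_iff_W {P : Type v} [SmallCategory P] (T : P ⥤ Arrow D)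
    (hS : S.rlp.llp = L) (hΛ : Λ.rlp.llp = An)
    (hL : ∀ X : D, L (initial.to X))
    (κ : Cardinal.{v}) [Fact κ.IsRegular]
    (hSκ : ∀ ⦃A B : D⦄ (i : A ⟶ B), S i → IsCardinalPresentable A κ ∧ IsCardinalPresentable B κ)
    (hΛκ : ∀ ⦃A B : D⦄ (i : A ⟶ B), Λ i → IsCardinalPresentable A κ ∧ IsCardinalPresentable B κ) :
    ∃ (Prob : P → Type v) (Sol : ∀ (s t : P), Prob s → (s ⟶ t) → Prop),
      ∀ {J : Type v} [SmallCategory J] [IsCardinalFiltered J κ] (τ : J ⥤ P),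
        H.W (colimit (τ ⋙ T)).hom ↔ IsSaturated Prob Sol τ := by
  have hcomplete := hasLimitsOfSize_of_isLocallyPresentable D
  have hA : An.rlp = Λ.rlp := by rw [← hΛ, MorphismProperty.rlp_llp_rlp]
  have hL' : L.rlp = S.rlp := by rw [← hS, MorphismProperty.rlp_llp_rlp]
  have : MorphismProperty.HasSmallObjectArgument.{v} (freeDiagrams P Λ) :=
    hasSmallObjectArgument_freeDiagrams P Λ (fun A B i hi ↦ by
      have := (hΛκ i hi).1
      exact isPresentable_of_isCardinalPresentable _ κ)
  let w := Functor.whiskerLeft T Arrow.leftToRight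
  -- Factoring in the diagram category makes the factorizations natural in `t`, so they can be
  -- restricted along `τ` and passed to the colimit.
  let r := MorphismProperty.factorizationData (freeDiagrams P Λ).rlp.llp (freeDiagrams P Λ).rlp
    (show T ⋙ Arrow.rightFunc ⟶ (Functor.const P).obj (⊤_ D) from
      { app _ := terminal.from _, naturality _ _ _ := Subsingleton.elim (α := _ ⟶ ⊤_ D) _ _ })
  let φ := MorphismProperty.factorizationData (freeDiagrams P Λ).rlp.llp (freeDiagrams P Λ).rlp
    (w ≫ r.i)
  -- A problem at `t` is a square from a generating cofibration to `φ.p.app t`; a solution along `f`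
  -- is a lift after transport along `f`.
  let Prob (t : P) := Σ (i : Shrink.{v} S.toSet),
    { x : (((equivShrink _).symm i).1.left ⟶ φ.Z.obj t) ×
      (((equivShrink _).symm i).1.right ⟶ r.Z.obj t) //
        x.1 ≫ φ.p.app t = ((equivShrink _).symm i).1.hom ≫ x.2 }
  let Sol (s t : P) (x : Prob s) (f : s ⟶ t) : Prop :=
    ∃ l : ((equivShrink _).symm x.1).1.right ⟶ φ.Z.obj t,
      ((equivShrink _).symm x.1).1.hom ≫ l = x.2.1.1 ≫ φ.Z.map f ∧
        l ≫ φ.p.app t = x.2.1.2 ≫ r.Z.map f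
  refine ⟨Prob, Sol, fun {J} _ _ τ ↦ ?_⟩
  have e := arrowIsoOfIsColimit (colimit.isColimit (τ ⋙ T))
  have h₁ : H.W (colimit (τ ⋙ T)).hom ↔ H.W (colimMap (Functor.whiskerLeft τ w)) :=
    ((H.W).arrow_mk_iso_iff e).symm
  have h₂ : H.W (colimMap (Functor.whiskerLeft τ w)) ↔
      L.rlp (colimMap (Functor.whiskerLeft τ φ.p)) := by
    refine DirectedHomotopy.W.iff_rlp hL (r := colimMap (Functor.whiskerLeft τ r.i))
      (i := colimMap (Functor.whiskerLeft τ φ.i)) ?_ ?_ ?_ ?_ ?_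
    · rw [← hΛ]
      exact llp_rlp_colimMap P Λ τ _ r.hi
    -- Fibrancy survives the colimit: a map from a presentable source factors through a stage and is
    -- extended there.
    · rw [IsNaiveFibrant, hA]
      intro A B i hi
      obtain ⟨_, _⟩ := hΛκ i hi
      refine ⟨fun {a b} sq ↦ ?_⟩
      obtain ⟨j, a', ha'⟩ := IsCardinalPresentable.exists_hom_of_isColimit κ
        (colimit.isColimit (τ ⋙ r.Z)) a
      have := (rlp_freeDiagrams_iff Λ _).1 r.hp (τ.obj j) _ hi
      have sq' : CommSq a' i (r.p.app (τ.obj j)) (terminal.from B) :=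
        ⟨Subsingleton.elim (α := _ ⟶ ⊤_ D) _ _⟩
      refine ⟨⟨⟨sq'.lift ≫ colimit.ι (τ ⋙ r.Z) j, ?_, Subsingleton.elim _ _⟩⟩⟩
      rw [← ha']
      exact (sq'.fac_left_assoc _)
    · rw [← hΛ]
      exact llp_rlp_colimMap P Λ τ _ φ.hi
    · rw [hA]
      intro A B i hi
      obtain ⟨_, _⟩ := hΛκ i hi
      rw [hasLiftingProperty_colimMap_iff κ]
      intro j a b hab
      have := (rlp_freeDiagrams_iff Λ _).1 φ.hp (τ.obj j) _ hi
      have sq : CommSq a i (φ.p.app (τ.obj j)) b := ⟨hab⟩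
      exact ⟨j, 𝟙 j, sq.lift, by simp, by simp⟩
    · refine colimit.hom_ext (fun j ↦ ?_)
      have fac : φ.i.app (τ.obj j) ≫ φ.p.app (τ.obj j) = w.app (τ.obj j) ≫ r.i.app (τ.obj j) :=
        NatTrans.congr_app φ.fac _
      simpa using congr_arg (· ≫ colimit.ι (τ ⋙ r.Z) j) fac
  rw [h₁, h₂, hL']
  constructor
  · rintro h j ⟨i, ⟨a, b⟩, hab⟩
    have hi := ((equivShrink _).symm i).2
    have := h _ hi
    obtain ⟨_, _⟩ := hSκ _ hi
    rw [hasLiftingProperty_colimMap_iff κ] at this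
    exact this j a b hab
  · intro h A B i hi
    obtain ⟨_, _⟩ := hSκ _ hi
    rw [hasLiftingProperty_colimMap_iff κ]
    intro j a b hab
    obtain ⟨x, hx⟩ := (equivShrink.{v} S.toSet).symm.surjective ⟨Arrow.mk i, hi⟩
    have key : ∀ (y : S.toSet) (hy : (equivShrink.{v} S.toSet).symm x = y)
        (a : y.1.left ⟶ φ.Z.obj (τ.obj j)) (b : y.1.right ⟶ r.Z.obj (τ.obj j))
        (hab : a ≫ φ.p.app _ = y.1.hom ≫ b),
        ∃ (k : J) (f : j ⟶ k) (l : y.1.right ⟶ φ.Z.obj (τ.obj k)),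
          y.1.hom ≫ l = a ≫ φ.Z.map (τ.map f) ∧ l ≫ φ.p.app _ = b ≫ r.Z.map (τ.map f) := by
      rintro _ rfl a b hab
      obtain ⟨k, f, l, hl⟩ := h j ⟨x, ⟨a, b⟩, hab⟩
      exact ⟨k, f, l, hl⟩
    exact key _ hx a b hab

/-- The solution set condition for weak equivalences. -/
theorem exists_solution_set (hS : S.rlp.llp = L) (hΛ : Λ.rlp.llp = An)
    (hL : ∀ X : D, L (initial.to X)) :
    ∃ W₀ : MorphismProperty D, MorphismProperty.IsSmall.{v} W₀ ∧ W₀ ≤ H.W ∧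
      ∀ ⦃A B X Y : D⦄ (i : A ⟶ B) (w : X ⟶ Y) (_ : S i) (_ : H.W w)
        (φ : Arrow.mk i ⟶ Arrow.mk w), ∃ (A' B' : D) (w₀ : A' ⟶ B') (_ : W₀ w₀)
          (α : Arrow.mk i ⟶ Arrow.mk w₀) (β : Arrow.mk w₀ ⟶ Arrow.mk w), α ≫ β = φ := by
  have (X : D) : IsPresentable.{v} X := inferInstance
  obtain ⟨κ₀, _, _⟩ := IsLocallyPresentable.exists_cardinal.{v} D
  obtain ⟨κ, _, hκ₀, hκ⟩ := exists_regular_cardinal_isCardinalPresentable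
    (Sum.elim (Sum.elim (fun i : S.toSet ↦ i.1.left) (fun i : S.toSet ↦ i.1.right))
      (Sum.elim (fun i : Λ.toSet ↦ i.1.left) (fun i : Λ.toSet ↦ i.1.right))) κ₀
  have hSκ ⦃A B : D⦄ (i : A ⟶ B) (hi : S i) :
      IsCardinalPresentable A κ ∧ IsCardinalPresentable B κ :=
    ⟨hκ (.inl (.inl ⟨Arrow.mk i, hi⟩)), hκ (.inl (.inr ⟨Arrow.mk i, hi⟩))⟩
  have hΛκ ⦃A B : D⦄ (i : A ⟶ B) (hi : Λ i) :
      IsCardinalPresentable A κ ∧ IsCardinalPresentable B κ :=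
    ⟨hκ (.inr (.inl ⟨Arrow.mk i, hi⟩)), hκ (.inr (.inr ⟨Arrow.mk i, hi⟩))⟩
  have : IsCardinalLocallyPresentable D κ := .of_le D hκ₀
  let e := equivSmallModel.{v} (isCardinalPresentable (Arrow D) κ).FullSubcategory
  let P := SmallModel.{v} (isCardinalPresentable (Arrow D) κ).FullSubcategory
  let T : P ⥤ Arrow D := e.inverse ⋙ ObjectProperty.ι _
  obtain ⟨Prob, Sol, hsat⟩ := exists_saturated_iff_W H S Λ T hS hΛ hL κ hSκ hΛκ
  let Tm := DirectedTerm κ (Σ t, Prob t)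
  -- The solution set consists of the colimits, when weak equivalences, of all diagrams indexed by
  -- preorders on the fixed type of terms.
  let ι := Σ (_ : Preorder Tm), { τ : Tm ⥤ P // H.W (colimit (τ ⋙ T)).hom }
  let f (x : ι) : Arrow D := letI := x.1; colimit (x.2.1 ⋙ T)
  refine ⟨.ofHoms (fun x : ι ↦ (f x).hom), inferInstance, ?_, ?_⟩
  · rintro _ _ _ ⟨_, _, hτ⟩
    exact hτ
  · intro A B X Y i w hi hw φ
    obtain ⟨J, _, _, ⟨p⟩⟩ := (isCardinalFilteredGenerator_isCardinalPresentable
      (Arrow D) κ).exists_colimitsOfShape (Arrow.mk w)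
    obtain ⟨α, _, _, F, _⟩ := IsCardinalFiltered.exists_cardinal_directed J κ
    let G : α ⥤ (isCardinalPresentable (Arrow D) κ).FullSubcategory :=
      ObjectProperty.lift _ (F ⋙ p.diag) (fun j ↦ p.prop_diag_obj (F.obj j))
    let iso : (G ⋙ e.functor) ⋙ T ≅ F ⋙ p.diag :=
      Functor.associator _ _ _ ≪≫
      G.isoWhiskerLeft ((Functor.associator _ _ _).symm ≪≫
      Functor.isoWhiskerRight e.unitIso.symm (ObjectProperty.ι _)) ≪≫
      (Functor.associator _ _ _).symm ≪≫
      Functor.isoWhiskerRight (Functor.rightUnitor _) _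
    let c := (Cocone.precompose iso.hom).obj (p.toColimitPresentation.reindex F).cocone
    have hc : IsColimit c := (IsColimit.precomposeHomEquiv iso _).2
      (p.toColimitPresentation.reindex F).isColimit
    have : IsCardinalPresentable (Arrow.mk i).left κ := (hSκ i hi).1
    have : IsCardinalPresentable (Arrow.mk i).right κ := (hSκ i hi).2
    obtain ⟨j, φ', hφ'⟩ := IsCardinalPresentable.exists_hom_of_isColimit κ hc φ
    have hsat' : IsSaturated Prob Sol (G ⋙ e.functor) := by
      rw [← hsat]
      exact ((H.W).arrow_mk_iso_iff
        ((colimit.isColimit ((G ⋙ e.functor) ⋙ T)).coconePointUniqueUpToIso hc)).2 hw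
    -- The base term is sent to the stage `j` through which `φ` factors, so the factorization
    -- persists in the subdiagram.
    obtain ⟨_, E, _, hE, rfl⟩ := hsat'.exists_directedTerm (κ := κ) j
    rw [← hsat] at hE
    exact ⟨_, _, _, MorphismProperty.ofHoms.mk (⟨inferInstance, _, hE⟩ : ι),
      φ' ≫ colimit.ι ((E ⋙ G ⋙ e.functor) ⋙ T) .base,
      colimit.desc ((E ⋙ G ⋙ e.functor) ⋙ T) (c.whisker E),
      (Category.assoc _ _ _).trans
        ((congr_arg (φ' ≫ ·) (colimit.ι_desc (c.whisker E) DirectedTerm.base)).trans hφ')⟩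

end DirectedCylinder

/-! ### Smith's theorem and existence of the model structure -/

namespace DirectedCylinder

variable {D : Type u} [Category.{v} D]

/-- Smith's construction of a generating set of trivial cofibrations from a solution set. -/
lemma exists_generating_trivial_cofibrations [HasPushouts D] {L W S W₀ : MorphismProperty D}
    [MorphismProperty.IsSmall.{v} S] [MorphismProperty.IsSmall.{v} W₀]
    [W.HasTwoOutOfThreeProperty] [L.HasFactorization L.rlp]
    (hS : S.rlp.llp = L) (hLW : L.rlp ≤ W) (hW₀ : W₀ ≤ W)
    (h : ∀ ⦃A B X Y : D⦄ (i : A ⟶ B) (w : X ⟶ Y) (_ : S i) (_ : W w)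
        (φ : Arrow.mk i ⟶ Arrow.mk w), ∃ (A' B' : D) (w₀ : A' ⟶ B') (_ : W₀ w₀)
          (α : Arrow.mk i ⟶ Arrow.mk w₀) (β : Arrow.mk w₀ ⟶ Arrow.mk w), α ≫ β = φ) :
    ∃ J : MorphismProperty D, MorphismProperty.IsSmall.{v} J ∧ J ≤ L ⊓ W ∧ J.rlp ⊓ W ≤ L.rlp := by
  have hSL : S ≤ L := by rw [← hS]; exact S.le_llp_rlp
  have : L.IsMultiplicative := by rw [← hS]; infer_instance
  have : L.IsStableUnderCobaseChange := by rw [← hS]; infer_instance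
  let ι := Σ (x : S.toSet × W₀.toSet), x.1.1 ⟶ x.2.1
  have hc (x : ι) : x.1.1.1.hom ≫ x.2.right = x.2.left ≫ x.1.2.1.hom := (Arrow.w x.2).symm
  let φ (x : ι) := MorphismProperty.factorizationData L L.rlp
    (pushout.desc x.2.right x.1.2.1.hom (hc x))
  -- A pushout of a generating cofibration followed by a cofibration, hence a cofibration. It is a
  -- weak equivalence because following it by a trivial fibration gives `w₀`.
  let j (x : ι) : x.1.2.1.left ⟶ (φ x).Z := pushout.inr _ _ ≫ (φ x).i
  have hj (x : ι) : j x ≫ (φ x).p = x.1.2.1.hom :=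
    (Category.assoc _ _ _).trans ((congr_arg (pushout.inr _ _ ≫ ·) (φ x).fac).trans
      (pushout.inr_desc _ _ _))
  refine ⟨.ofHoms j, inferInstance, ?_, ?_⟩
  · rintro _ _ _ ⟨x⟩
    refine ⟨MorphismProperty.comp_mem _ _ _
      (MorphismProperty.pushout_inr _ _ (hSL _ x.1.1.2)) (φ x).hi, ?_⟩
    exact W.of_postcomp _ _ (hLW _ (φ x).hp) (by rw [hj]; exact hW₀ _ x.1.2.2)
  · rintro X Y w ⟨hw, hw'⟩
    rw [← hS, MorphismProperty.rlp_llp_rlp]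
    intro A B i hi
    refine ⟨fun {a b} sq ↦ ?_⟩
    -- The square from `i` to `w` factors through `w₀`; a lift against the corresponding `j x`
    -- restricts to one against `i`.
    obtain ⟨A', B', w₀, h₀, α, β, hαβ⟩ := h i w hi hw' (Arrow.homMk a b sq.w)
    let x : ι := ⟨⟨⟨Arrow.mk i, hi⟩, ⟨Arrow.mk w₀, h₀⟩⟩, α⟩
    have := hw _ (MorphismProperty.ofHoms.mk x)
    have sq' : CommSq β.left (j x) w ((φ x).p ≫ β.right) := ⟨by
      rw [reassoc_of% (hj x)]
      exact Arrow.w β⟩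
    have h₁ : α.left ≫ β.left = a := congr_arg Arrow.Hom.left hαβ
    have h₂ : α.right ≫ β.right = b := congr_arg Arrow.Hom.right hαβ
    have hc' : i ≫ pushout.inl i α.left = α.left ≫ pushout.inr i α.left := pushout.condition
    have e₁ : pushout.inr i α.left ≫ (φ x).i ≫ sq'.lift = β.left :=
      (Category.assoc _ _ _).symm.trans sq'.fac_left
    have e₂ : pushout.inl i α.left ≫ (φ x).i ≫ (φ x).p = α.right :=
      (congr_arg (pushout.inl i α.left ≫ ·) (φ x).fac).trans (pushout.inl_desc _ _ _)
    refine ⟨⟨⟨pushout.inl i α.left ≫ (φ x).i ≫ sq'.lift, ?_, ?_⟩⟩⟩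
    · rw [reassoc_of% hc', e₁, h₁]
    · rw [Category.assoc, Category.assoc, sq'.fac_right, ← h₂]
      simpa using congr_arg (· ≫ β.right) e₂

variable [IsLocallyPresentable.{v} D]

lemma hasFactorization_llp_rlp (S : MorphismProperty D) [MorphismProperty.IsSmall.{v} S] :
    S.rlp.llp.HasFactorization S.rlp := by
  have : MorphismProperty.HasSmallObjectArgument.{v} S :=
    hasSmallObjectArgument_of_isPresentable S (fun _ _ _ _ ↦ inferInstance)
  infer_instance

lemma hasFactorization_of_eq_llp_rlp {S L : MorphismProperty D} [MorphismProperty.IsSmall.{v} S]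
    (hS : S.rlp.llp = L) : L.HasFactorization L.rlp := by
  rw [← hS, MorphismProperty.rlp_llp_rlp]
  exact hasFactorization_llp_rlp S

variable {L An : MorphismProperty D} [HasTerminal D] [HasInitial D]

/-- The model structure attached to a directed homotopy structure on a locally presentable
category. -/
theorem exists_modelCategory (H : DirectedHomotopy L An) (S Λ : MorphismProperty D)
    [MorphismProperty.IsSmall.{v} S] [MorphismProperty.IsSmall.{v} Λ]
    (hS : S.rlp.llp = L) (hΛ : Λ.rlp.llp = An) (hAn : An ≤ L)
    (hL : ∀ X : D, L (initial.to X)) :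
    ∃ _ : ModelCategory D, (∀ {X Y : D} (f : X ⟶ Y), Cofibration f ↔ L f) ∧
      (∀ X : D, IsFibrant X ↔ IsNaiveFibrant An X) := by
  have := hasLimitsOfSize_of_isLocallyPresentable D
  have := hasFactorization_of_eq_llp_rlp hS
  have := hasFactorization_of_eq_llp_rlp hΛ
  have hS' : L.rlp.llp = L := by rw [← hS, MorphismProperty.rlp_llp_rlp]
  have hΛ' : An.rlp.llp = An := by rw [← hΛ, MorphismProperty.rlp_llp_rlp]
  have hR : L.rlp ≤ H.W := fun _ _ _ hp ↦ .of_rlp hL hp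
  obtain ⟨W₀, _, hW₀, h⟩ := exists_solution_set H S Λ hS hΛ hL
  obtain ⟨J, _, hJ₁, hJ₂⟩ := exists_generating_trivial_cofibrations hS hR hW₀ h
  have hTC := H.inf_W_eq hL hAn hΛ' hS'
  have hJ : J.rlp.llp = L ⊓ H.W := by
    -- Trivial cofibrations form a left lifting class, so they contain everything generated by `J`.
    have hJ' : J.rlp.llp ≤ L ⊓ H.W := by
      rw [hTC] at hJ₁ ⊢
      exact (MorphismProperty.antitone_llp (MorphismProperty.antitone_rlp hJ₁)).trans
        (by rw [MorphismProperty.llp_rlp_llp])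
    refine le_antisymm hJ' ?_
    rintro X Y f ⟨hf, hf'⟩
    have := hasFactorization_llp_rlp J
    -- Retract argument: by two-out-of-three `φ.p` is a weak equivalence in `J.rlp`, hence a trivial
    -- fibration, and `f` lifts against it.
    let φ := MorphismProperty.factorizationData J.rlp.llp J.rlp f
    have hp : H.W φ.p := (H.W).of_precomp _ _ (hJ' _ φ.hi).2 (by rwa [φ.fac])
    have := hJ₂ _ ⟨φ.hp, hp⟩ _ hf
    exact MorphismProperty.of_retract (RetractArrow.ofLeftLiftingProperty φ.fac) φ.hi
  let : CategoryWithCofibrations D := ⟨L⟩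
  let : CategoryWithWeakEquivalences D := ⟨H.W⟩
  let : CategoryWithFibrations D := ⟨J.rlp⟩
  have hF : trivialFibrations D = L.rlp := by
    refine le_antisymm hJ₂ (le_inf ?_ hR)
    change _ ≤ J.rlp
    rw [← J.rlp_llp_rlp, hJ]
    exact MorphismProperty.antitone_rlp inf_le_left
  have : (weakEquivalences D).HasTwoOutOfThreeProperty :=
    inferInstanceAs (H.W).HasTwoOutOfThreeProperty
  have : MorphismProperty.IsWeakFactorizationSystem (cofibrations D) (trivialFibrations D) := by
    rw [hF]
    exact { rlp := rfl, llp := hS', hasFactorization := ‹_› }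
  have : MorphismProperty.IsWeakFactorizationSystem (trivialCofibrations D) (fibrations D) := by
    have := hasFactorization_of_eq_llp_rlp hJ
    change MorphismProperty.IsWeakFactorizationSystem (L ⊓ H.W) J.rlp
    rw [← J.rlp_llp_rlp, hJ]
    exact { rlp := rfl, llp := by rw [← hJ, MorphismProperty.rlp_llp_rlp] }
  refine ⟨ModelCategory.mk' D, fun f ↦ cofibration_iff f, fun X ↦ ?_⟩
  rw [isFibrant_iff, fibration_iff]
  change J.rlp _ ↔ _
  rw [← J.rlp_llp_rlp, hJ]
  constructor
  · exact fun h A B i hi ↦ h _ ⟨hAn _ hi, .of_anodyne hi⟩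
  -- The map to the terminal object is a naive fibration with fibrant target, against which trivial
  -- cofibrations lift.
  · intro h A B i hi
    rw [hTC] at hi
    exact hi _ (Or.inr ⟨h, isNaiveFibrant_terminal An⟩)

end DirectedCylinder

/-! ### Directed homotopies from an exact cylinder -/

namespace DirectedCylinder

namespace FunctorialCylinder

variable {C : Type u} [Category.{v} C] [HasBinaryCoproducts C]
  {L : MorphismProperty C} (cyl : FunctorialCylinder L)

lemma inl_bd_assoc [HasPushouts C] (X : C) {Z : C} (f : cyl.I.obj X ⟶ Z) :
    coprod.inl ≫ cyl.bd X ≫ f = cyl.d₀.app X ≫ f :=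
  coprod.inl_desc_assoc _ _ _

lemma inr_bd_assoc [HasPushouts C] (X : C) {Z : C} (f : cyl.I.obj X ⟶ Z) :
    coprod.inr ≫ cyl.bd X ≫ f = cyl.d₁.app X ≫ f :=
  coprod.inr_desc_assoc _ _ _

@[simp]
lemma d₀_app_σ_app (X : C) : cyl.d₀.app X ≫ cyl.σ.app X = 𝟙 X :=
  NatTrans.congr_app cyl.d₀_σ X

@[simp]
lemma d₁_app_σ_app (X : C) : cyl.d₁.app X ≫ cyl.σ.app X = 𝟙 X :=
  NatTrans.congr_app cyl.d₁_σ X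

lemma exists_lift_bd [HasPushouts C] {X E B : C} (p : E ⟶ B) (hp : L.rlp p) (a₀ a₁ : X ⟶ E)
    (b : cyl.I.obj X ⟶ B) (h₀ : cyl.d₀.app X ≫ b = a₀ ≫ p) (h₁ : cyl.d₁.app X ≫ b = a₁ ≫ p) :
    ∃ h : cyl.I.obj X ⟶ E, cyl.d₀.app X ≫ h = a₀ ∧ cyl.d₁.app X ≫ h = a₁ ∧ h ≫ p = b := by
  have : HasLiftingProperty (cyl.bd X) p := hp _ (cyl.mem X)
  have sq : CommSq (coprod.desc a₀ a₁) (cyl.bd X) p b := ⟨coprod.hom_ext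
    ((coprod.inl_desc_assoc _ _ _).trans (h₀.symm.trans (cyl.inl_bd_assoc X b).symm))
    ((coprod.inr_desc_assoc _ _ _).trans (h₁.symm.trans (cyl.inr_bd_assoc X b).symm))⟩
  refine ⟨sq.lift, ?_, ?_, sq.fac_right⟩
  · rw [← inl_bd_assoc, sq.fac_left, coprod.inl_desc]
  · rw [← inr_bd_assoc, sq.fac_left, coprod.inr_desc]

variable [HasPushouts C] {An : MorphismProperty C}

lemma exists_lift_endBox (d : 𝟭 C ⟶ cyl.I) {K M E B : C} (j : K ⟶ M)
    (p : E ⟶ B) [HasLiftingProperty (cyl.endBox d j) p]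
    (a : M ⟶ E) (h : cyl.I.obj K ⟶ E) (b : cyl.I.obj M ⟶ B) (h₁ : d.app K ≫ h = j ≫ a)
    (h₂ : d.app M ≫ b = a ≫ p) (h₃ : cyl.I.map j ≫ b = h ≫ p) :
    ∃ k : cyl.I.obj M ⟶ E, d.app M ≫ k = a ∧ cyl.I.map j ≫ k = h ∧ k ≫ p = b := by
  have e₁ : pushout.inl j (d.app K) ≫ cyl.endBox d j = d.app M := pushout.inl_desc _ _ _
  have e₂ : pushout.inr j (d.app K) ≫ cyl.endBox d j = cyl.I.map j := pushout.inr_desc _ _ _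
  have sq : CommSq (pushout.desc a h h₁.symm) (cyl.endBox d j) p b := ⟨pushout.hom_ext
    (by rw [reassoc_of% e₁, pushout.inl_desc_assoc]; exact h₂.symm)
    (by rw [reassoc_of% e₂, pushout.inr_desc_assoc]; exact h₃.symm)⟩
  refine ⟨sq.lift, ?_, ?_, sq.fac_right⟩
  · rw [← e₁, Category.assoc, sq.fac_left, pushout.inl_desc]
  · rw [← e₂, Category.assoc, sq.fac_left, pushout.inr_desc]

lemma exists_lift_bdBox {K M E B : C} (j : K ⟶ M)
    (p : E ⟶ B) [HasLiftingProperty (cyl.bdBox j) p]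
    (a₀ a₁ : M ⟶ E) (h : cyl.I.obj K ⟶ E) (b : cyl.I.obj M ⟶ B)
    (h₀ : cyl.d₀.app K ≫ h = j ≫ a₀) (h₁ : cyl.d₁.app K ≫ h = j ≫ a₁)
    (hb₀ : cyl.d₀.app M ≫ b = a₀ ≫ p) (hb₁ : cyl.d₁.app M ≫ b = a₁ ≫ p)
    (hb : cyl.I.map j ≫ b = h ≫ p) :
    ∃ k : cyl.I.obj M ⟶ E, cyl.d₀.app M ≫ k = a₀ ∧ cyl.d₁.app M ≫ k = a₁ ∧
      cyl.I.map j ≫ k = h ∧ k ≫ p = b := by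
  have e₁ : pushout.inl (coprod.map j j) (cyl.bd K) ≫ cyl.bdBox j = cyl.bd M :=
    pushout.inl_desc _ _ _
  have e₂ : pushout.inr (coprod.map j j) (cyl.bd K) ≫ cyl.bdBox j = cyl.I.map j :=
    pushout.inr_desc _ _ _
  have sq : CommSq (pushout.desc (coprod.desc a₀ a₁) h (coprod.hom_ext
      ((coprod.inl_map_assoc _ _ _).trans ((congr_arg (j ≫ ·) (coprod.inl_desc _ _)).trans
        (h₀.symm.trans (cyl.inl_bd_assoc K h).symm)))
      ((coprod.inr_map_assoc _ _ _).trans ((congr_arg (j ≫ ·) (coprod.inr_desc _ _)).trans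
        (h₁.symm.trans (cyl.inr_bd_assoc K h).symm))))) (cyl.bdBox j) p b := ⟨pushout.hom_ext
    (by
      rw [reassoc_of% e₁, pushout.inl_desc_assoc]
      exact coprod.hom_ext
        ((coprod.inl_desc_assoc _ _ _).trans (hb₀.symm.trans (cyl.inl_bd_assoc M b).symm))
        ((coprod.inr_desc_assoc _ _ _).trans (hb₁.symm.trans (cyl.inr_bd_assoc M b).symm)))
    (by rw [reassoc_of% e₂, pushout.inr_desc_assoc]; exact hb.symm)⟩
  have e : cyl.bd M ≫ sq.lift = coprod.desc a₀ a₁ := by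
    rw [← e₁, Category.assoc, sq.fac_left, pushout.inl_desc]
  refine ⟨sq.lift, ?_, ?_, ?_, sq.fac_right⟩
  · rw [← inl_bd_assoc, e, coprod.inl_desc]
  · rw [← inr_bd_assoc, e, coprod.inr_desc]
  · rw [← e₂, Category.assoc, sq.fac_left, pushout.inr_desc]

/-- Since `I` preserves the initial object, the end box of `⊥_ C ⟶ X` imposes no condition beyond
the end `d.app X`. -/
lemma exists_lift_of_end [PreservesColimit (Functor.empty.{0} C) cyl.I] [HasInitial C]
    (d : 𝟭 C ⟶ cyl.I) {X E B : C} (p : E ⟶ B)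
    [HasLiftingProperty (cyl.endBox d (initial.to X)) p] (a : X ⟶ E) (b : cyl.I.obj X ⟶ B)
    (h : d.app X ≫ b = a ≫ p) : ∃ k : cyl.I.obj X ⟶ E, d.app X ≫ k = a ∧ k ≫ p = b := by
  have hI : IsInitial (cyl.I.obj (⊥_ C)) := IsInitial.isInitialObj cyl.I _ initialIsInitial
  obtain ⟨k, h₁, -, h₂⟩ := cyl.exists_lift_endBox d (initial.to X) p a (hI.to E) b
    (initialIsInitial.hom_ext _ _) h (hI.hom_ext _ _)
  exact ⟨k, h₁, h₂⟩

/-- Since `I` preserves `X ⨿ X`, the sides `l₀` and `l₁` glue; with `m` they form a map out of the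
source of `endBox d (bd X)`. -/
lemma exists_lift_square {X : C} [PreservesColimit (pair X X) cyl.I]
    (d : 𝟭 C ⟶ cyl.I) {E B : C} (p : E ⟶ B)
    [HasLiftingProperty (cyl.endBox d (cyl.bd X)) p] (l₀ l₁ m : cyl.I.obj X ⟶ E)
    (β : cyl.I.obj (cyl.I.obj X) ⟶ B) (h₀ : d.app X ≫ l₀ = cyl.d₀.app X ≫ m)
    (h₁ : d.app X ≫ l₁ = cyl.d₁.app X ≫ m)
    (hβ₀ : cyl.I.map (cyl.d₀.app X) ≫ β = l₀ ≫ p) (hβ₁ : cyl.I.map (cyl.d₁.app X) ≫ β = l₁ ≫ p)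
    (hβ : d.app (cyl.I.obj X) ≫ β = m ≫ p) :
    ∃ k : cyl.I.obj (cyl.I.obj X) ⟶ E, cyl.I.map (cyl.d₀.app X) ≫ k = l₀ ∧
      cyl.I.map (cyl.d₁.app X) ≫ k = l₁ ∧ k ≫ p = β := by
  have hc : IsColimit (BinaryCofan.mk (cyl.I.map (coprod.inl : X ⟶ X ⨿ X))
      (cyl.I.map (coprod.inr : X ⟶ X ⨿ X))) :=
    mapIsColimitOfPreservesOfIsColimit cyl.I _ _ (coprodIsCoprod X X)
  let l : cyl.I.obj (X ⨿ X) ⟶ E := BinaryCofan.IsColimit.desc hc l₀ l₁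
  have hl₀ : cyl.I.map coprod.inl ≫ l = l₀ := BinaryCofan.IsColimit.inl_desc hc l₀ l₁
  have hl₁ : cyl.I.map coprod.inr ≫ l = l₁ := BinaryCofan.IsColimit.inr_desc hc l₀ l₁
  have b₀ : coprod.inl ≫ cyl.bd X = cyl.d₀.app X := coprod.inl_desc _ _
  have b₁ : coprod.inr ≫ cyl.bd X = cyl.d₁.app X := coprod.inr_desc _ _
  have n₀ : d.app X ≫ cyl.I.map coprod.inl = (coprod.inl : X ⟶ X ⨿ X) ≫ d.app (X ⨿ X) :=
    (d.naturality _).symm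
  have n₁ : d.app X ≫ cyl.I.map coprod.inr = (coprod.inr : X ⟶ X ⨿ X) ≫ d.app (X ⨿ X) :=
    (d.naturality _).symm
  obtain ⟨k, -, hk, hkp⟩ := cyl.exists_lift_endBox d (cyl.bd X) p m l β
    (coprod.hom_ext
      (by rw [← reassoc_of% n₀, hl₀, h₀, reassoc_of% b₀])
      (by rw [← reassoc_of% n₁, hl₁, h₁, reassoc_of% b₁])) hβ
    (BinaryCofan.IsColimit.hom_ext hc
      (by
        change cyl.I.map coprod.inl ≫ _ = cyl.I.map coprod.inl ≫ _
        rw [reassoc_of% hl₀, ← Functor.map_comp_assoc, b₀, hβ₀])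
      (by
        change cyl.I.map coprod.inr ≫ _ = cyl.I.map coprod.inr ≫ _
        rw [reassoc_of% hl₁, ← Functor.map_comp_assoc, b₁, hβ₁]))
  exact ⟨k, by rw [← b₀, Functor.map_comp, Category.assoc, hk, hl₀],
    by rw [← b₁, Functor.map_comp, Category.assoc, hk, hl₁], hkp⟩

variable {cyl} [HasColimitsOfSize.{v, v} C]

/-- The directed homotopies for a class of right anodyne extensions. -/
noncomputable def IsExact.rightDirectedHomotopy (hcyl : cyl.IsExact)
    (hL : ∀ X : C, L (initial.to X)) (hAn : cyl.IsRightAnodyneClass An) :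
    DirectedHomotopy L An where
  I := cyl.I
  e := cyl.d₀
  d := cyl.d₁
  σ := cyl.σ
  e_σ := by simp
  d_σ := by simp
  homotopy_lift_of_rlp p hp a₀ a₁ b h₀ h₁ := cyl.exists_lift_bd p hp a₀ a₁ b h₀ h₁
  homotopy_extension j hj p hp a h b h₁ h₂ h₃ := by
    have := hp _ (hAn.endBox_mem j hj)
    exact cyl.exists_lift_endBox _ j p a h b h₁ h₂ h₃
  homotopy_lift {X _ _} p hp a b h := by
    have := hcyl.preservesColimits
    have := hp _ (hAn.endBox_mem _ (hL X))
    exact cyl.exists_lift_of_end _ p a b h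
  square_lift {X _ _} p hp l₀ l₁ m β h₀ h₁ hβ₀ hβ₁ hβ := by
    have := hcyl.preservesColimits
    have : HasLiftingProperty (cyl.endBox _ (cyl.bd X)) p := hp _ (hAn.endBox_mem _ (cyl.mem X))
    obtain ⟨k, hk₀, hk₁, hk⟩ := cyl.exists_lift_square cyl.d₁ p l₀ l₁ m β h₀ h₁ hβ₀ hβ₁ hβ
    -- Restricting the filler of the square to the free end gives the missing side.
    refine ⟨cyl.d₀.app _ ≫ k, ?_, ?_, by rw [Category.assoc, hk]⟩
    · rw [← hk₀]
      exact NatTrans.naturality_assoc cyl.d₀ (cyl.d₀.app X) k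
    · rw [← hk₁]
      exact NatTrans.naturality_assoc cyl.d₀ (cyl.d₁.app X) k
  homotopy_extension_of_anodyne j hj p hp a₀ a₁ h b h₀ h₁ hb₀ hb₁ hb := by
    have := hp _ (hAn.bdBox_mem j hj)
    exact cyl.exists_lift_bdBox j p a₀ a₁ h b h₀ h₁ hb₀ hb₁ hb

/-- The directed homotopies for a class of left anodyne extensions. -/
noncomputable def IsExact.leftDirectedHomotopy (hcyl : cyl.IsExact)
    (hL : ∀ X : C, L (initial.to X)) (hAn : cyl.IsLeftAnodyneClass An) :
    DirectedHomotopy L An where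
  I := cyl.I
  e := cyl.d₁
  d := cyl.d₀
  σ := cyl.σ
  e_σ := by simp
  d_σ := by simp
  homotopy_lift_of_rlp p hp a₀ a₁ b h₀ h₁ := by
    obtain ⟨h, h₁, h₂, h₃⟩ := cyl.exists_lift_bd p hp a₁ a₀ b h₁ h₀
    exact ⟨h, h₂, h₁, h₃⟩
  homotopy_extension j hj p hp a h b h₁ h₂ h₃ := by
    have := hp _ (hAn.endBox_mem j hj)
    exact cyl.exists_lift_endBox _ j p a h b h₁ h₂ h₃
  homotopy_lift {X _ _} p hp a b h := by
    have := hcyl.preservesColimits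
    have := hp _ (hAn.endBox_mem _ (hL X))
    exact cyl.exists_lift_of_end _ p a b h
  square_lift {X _ _} p hp l₀ l₁ m β h₀ h₁ hβ₀ hβ₁ hβ := by
    have := hcyl.preservesColimits
    have : HasLiftingProperty (cyl.endBox _ (cyl.bd X)) p := hp _ (hAn.endBox_mem _ (cyl.mem X))
    obtain ⟨k, hk₁, hk₀, hk⟩ := cyl.exists_lift_square cyl.d₀ p l₁ l₀ m β h₁ h₀ hβ₁ hβ₀ hβ
    refine ⟨cyl.d₁.app _ ≫ k, ?_, ?_, by rw [Category.assoc, hk]⟩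
    · rw [← hk₀]
      exact NatTrans.naturality_assoc cyl.d₁ (cyl.d₁.app X) k
    · rw [← hk₁]
      exact NatTrans.naturality_assoc cyl.d₁ (cyl.d₀.app X) k
  homotopy_extension_of_anodyne j hj p hp a₀ a₁ h b h₀ h₁ hb₀ hb₁ hb := by
    have := hp _ (hAn.bdBox_mem j hj)
    obtain ⟨k, h₁, h₂, h₃⟩ := cyl.exists_lift_bdBox j p a₁ a₀ h b h₁ h₀ hb₁ hb₀ hb
    exact ⟨k, h₂, h₁, h₃⟩

end FunctorialCylinder

end DirectedCylinder

/-! ### Passage to slice categories -/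

namespace DirectedCylinder

variable {C : Type u} [Category.{v} C] {A : C}

lemma hasLiftingProperty_of_left {X Y E B : Over A} (i : X ⟶ Y) (p : E ⟶ B)
    [HasLiftingProperty i.left p.left] : HasLiftingProperty i p := by
  refine ⟨fun {a b} sq ↦ ?_⟩
  have sq' : CommSq a.left i.left p.left b.left := ⟨congr_arg Over.Hom.left sq.w⟩
  exact ⟨⟨⟨Over.homMk sq'.lift (by rw [← Over.w p, sq'.fac_right_assoc, Over.w]),
    Over.OverMorphism.ext sq'.fac_left, Over.OverMorphism.ext sq'.fac_right⟩⟩⟩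

/-- The morphisms in a slice category whose underlying morphism is in a given class `S`, indexed by
`S` in such a way that they form a small set when `S` does. -/
def overGenerators (S : MorphismProperty C) (A : C) : MorphismProperty (Over A) :=
  .ofHoms (fun x : (Σ s : S.toSet, s.1.right ⟶ A) ↦
    (Over.homMk x.1.1.hom : Over.mk (x.1.1.hom ≫ x.2) ⟶ Over.mk x.2))

instance (S : MorphismProperty C) [MorphismProperty.IsSmall.{v} S] :
    MorphismProperty.IsSmall.{v} (overGenerators S A) := by
  dsimp [overGenerators]
  infer_instance

lemma overGenerators_le (S : MorphismProperty C) : overGenerators S A ≤ S.over := by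
  rintro _ _ _ ⟨s, _⟩
  exact s.2

lemma rlp_of_rlp_overGenerators (S : MorphismProperty C) {E B : Over A} (p : E ⟶ B)
    (hp : (overGenerators S A).rlp p) : S.rlp p.left := by
  intro X Y i hi
  refine ⟨fun {a b} sq ↦ ?_⟩
  let x : Σ s : S.toSet, s.1.right ⟶ A := ⟨⟨Arrow.mk i, hi⟩, b ≫ B.hom⟩
  have := hp _ (MorphismProperty.ofHoms.mk x)
  have sq' : CommSq (Over.homMk (U := Over.mk (i ≫ b ≫ B.hom)) a
      (by rw [← Over.w p, sq.w_assoc]; rfl))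
    (Over.homMk i : Over.mk (i ≫ b ≫ B.hom) ⟶ Over.mk (b ≫ B.hom)) p
    (Over.homMk b) := ⟨Over.OverMorphism.ext sq.w⟩
  have : HasLiftingProperty
    (Over.homMk i : Over.mk (i ≫ b ≫ B.hom) ⟶ Over.mk (b ≫ B.hom)) p := this
  exact ⟨⟨⟨sq'.lift.left, congr_arg Over.Hom.left sq'.fac_left,
    congr_arg Over.Hom.left sq'.fac_right⟩⟩⟩

lemma rlp_over (S : MorphismProperty C) : (S.over (X := A)).rlp = S.rlp.over := by
  ext E B p
  refine ⟨fun hp ↦ rlp_of_rlp_overGenerators S p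
    (MorphismProperty.antitone_rlp (overGenerators_le S) _ hp), fun hp X Y i hi ↦ ?_⟩
  have := hp _ hi
  exact hasLiftingProperty_of_left i p

lemma rlp_overGenerators (S : MorphismProperty C) : (overGenerators S A).rlp = S.rlp.over := by
  refine le_antisymm (fun _ _ p hp ↦ rlp_of_rlp_overGenerators S p hp) ?_
  rw [← rlp_over]
  exact MorphismProperty.antitone_rlp (overGenerators_le S)

/-- A factorization of `f.left` in `C` is already one over `A`, so the retract argument can be run
in the slice and forgotten down to `C`. -/
lemma llp_rlp_overGenerators (S : MorphismProperty C) [S.rlp.llp.HasFactorization S.rlp] :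
    (overGenerators S A).rlp.llp = S.rlp.llp.over := by
  rw [rlp_overGenerators]
  apply le_antisymm
  · intro X Y f hf
    let φ := MorphismProperty.factorizationData S.rlp.llp S.rlp f.left
    let i : X ⟶ Over.mk (φ.p ≫ Y.hom) := Over.homMk φ.i (by simp)
    let p : Over.mk (φ.p ≫ Y.hom) ⟶ Y := Over.homMk φ.p
    have : HasLiftingProperty f p := hf _ φ.hp
    have r : RetractArrow f i := .ofLeftLiftingProperty (p := p) (Over.OverMorphism.ext φ.fac)
    exact MorphismProperty.of_retract (P := S.rlp.llp) (r.map (Over.forget A)) φ.hi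
  · intro X Y i hi E B p hp
    have := hi _ hp
    exact hasLiftingProperty_of_left i p

/-- Lifts in a slice category. -/
def overLift {T E B : Over A} (p : E ⟶ B) (b : T ⟶ B) (h : T.left ⟶ E.left)
    (w : h ≫ p.left = b.left) : T ⟶ E :=
  Over.homMk h (by rw [← Over.w p, reassoc_of% w, Over.w])

/-- The cylinder functor on a slice category. -/
def DirectedHomotopy.overI {L An : MorphismProperty C} (H : DirectedHomotopy L An) (A : C) :
    Over A ⥤ Over A where
  obj X := Over.mk (H.σ.app X.left ≫ X.hom)
  map f := Over.homMk (H.I.map f.left)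

/-- Directed homotopies in a slice category. -/
def DirectedHomotopy.over {L An : MorphismProperty C} (H : DirectedHomotopy L An) (A : C) :
    DirectedHomotopy (L.over (X := A)) (An.over (X := A)) where
  I := H.overI A
  e :=
    { app X := Over.homMk (H.e.app X.left) (H.e_σ_assoc X.hom)
      naturality _ _ f := Over.OverMorphism.ext (H.e.naturality f.left) }
  d :=
    { app X := Over.homMk (H.d.app X.left) (H.d_σ_assoc X.hom)
      naturality _ _ f := Over.OverMorphism.ext (H.d.naturality f.left) }
  σ :=
    { app X := Over.homMk (H.σ.app X.left)
      naturality _ _ f := Over.OverMorphism.ext (H.σ.naturality f.left) }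
  e_σ X := Over.OverMorphism.ext (H.e_σ X.left)
  d_σ X := Over.OverMorphism.ext (H.d_σ X.left)
  homotopy_lift_of_rlp p hp a₀ a₁ b h₀ h₁ := by
    rw [rlp_over] at hp
    obtain ⟨h, e₀, e₁, e₂⟩ := H.homotopy_lift_of_rlp p.left hp a₀.left a₁.left b.left
      (congr_arg Over.Hom.left h₀) (congr_arg Over.Hom.left h₁)
    exact ⟨overLift p b h e₂, Over.OverMorphism.ext e₀,
      Over.OverMorphism.ext e₁, Over.OverMorphism.ext e₂⟩
  homotopy_extension j hj p hp a h b h₁ h₂ h₃ := by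
    rw [rlp_over] at hp
    obtain ⟨k, e₀, e₁, e₂⟩ := H.homotopy_extension j.left hj p.left hp a.left h.left b.left
      (congr_arg Over.Hom.left h₁) (congr_arg Over.Hom.left h₂) (congr_arg Over.Hom.left h₃)
    exact ⟨overLift p b k e₂, Over.OverMorphism.ext e₀,
      Over.OverMorphism.ext e₁, Over.OverMorphism.ext e₂⟩
  homotopy_lift p hp a b h := by
    rw [rlp_over] at hp
    obtain ⟨k, e₀, e₁⟩ := H.homotopy_lift p.left hp a.left b.left (congr_arg Over.Hom.left h)
    exact ⟨overLift p b k e₁, Over.OverMorphism.ext e₀,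
      Over.OverMorphism.ext e₁⟩
  square_lift {X _ _} p hp l₀ l₁ m β h₀ h₁ hβ₀ hβ₁ hβ := by
    rw [rlp_over] at hp
    let β' : H.I.obj (H.I.obj X.left) ⟶ _ := β.left
    have e₃ : H.I.map (H.e.app X.left) ≫ β' = l₀.left ≫ p.left := congr_arg Over.Hom.left hβ₀
    have e₄ : H.I.map (H.d.app X.left) ≫ β' = l₁.left ≫ p.left := congr_arg Over.Hom.left hβ₁
    have e₅ : H.d.app (H.I.obj X.left) ≫ β' = m.left ≫ p.left := congr_arg Over.Hom.left hβ
    obtain ⟨n, e₀, e₁, e₂⟩ := H.square_lift (X := X.left) p.left hp l₀.left l₁.left m.left β'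
      (congr_arg Over.Hom.left h₀) (congr_arg Over.Hom.left h₁) e₃ e₄ e₅
    let ε : (H.overI A).obj X ⟶ (H.overI A).obj ((H.overI A).obj X) :=
      Over.homMk (H.e.app (H.I.obj X.left)) (H.e_σ_assoc _)
    exact ⟨overLift p (ε ≫ β) n e₂, Over.OverMorphism.ext e₀,
      Over.OverMorphism.ext e₁, Over.OverMorphism.ext e₂⟩
  homotopy_extension_of_anodyne j hj p hp a₀ a₁ h b h₀ h₁ hb₀ hb₁ hb := by
    rw [rlp_over] at hp
    obtain ⟨k, e₀, e₁, e₂, e₃⟩ := H.homotopy_extension_of_anodyne j.left hj p.left hp a₀.left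
      a₁.left h.left b.left (congr_arg Over.Hom.left h₀) (congr_arg Over.Hom.left h₁)
      (congr_arg Over.Hom.left hb₀) (congr_arg Over.Hom.left hb₁) (congr_arg Over.Hom.left hb)
    exact ⟨overLift p b k e₃, Over.OverMorphism.ext e₀,
      Over.OverMorphism.ext e₁, Over.OverMorphism.ext e₂, Over.OverMorphism.ext e₃⟩

lemma isNaiveFibrant_over_iff [HasTerminal (Over A)] (An : MorphismProperty C) (X : Over A) :
    IsNaiveFibrant (An.over (X := A)) X ↔ An.rlp X.hom := by
  let φ : ⊤_ (Over A) ≅ Over.mk (𝟙 A) := terminalIsTerminal.uniqueUpToIso Over.mkIdTerminal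
  have hφ : φ.hom.left = (⊤_ (Over A)).hom := by simpa using Over.w φ.hom
  have : IsIso (⊤_ (Over A)).hom := by
    rw [← hφ]
    exact inferInstanceAs (IsIso ((Over.forget A).map φ.hom))
  rw [IsNaiveFibrant, rlp_over, MorphismProperty.over_iff, ← Over.w (terminal.from X)]
  exact (MorphismProperty.cancel_right_of_respectsIso _ _ _).symm

variable [IsLocallyPresentable.{v} C]

lemma initial_to_left_mem {L : MorphismProperty C} [L.RespectsIso]
    (hL : ∀ X : C, L (initial.to X)) (X : Over A) : L (initial.to X).left := by
  have hi : IsInitial (⊥_ (Over A)).left :=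
    IsInitial.isInitialObj (Over.forget A) _ initialIsInitial
  have fac : (initial.to X).left = hi.to (⊥_ C) ≫ initial.to X.left := hi.hom_ext _ _
  have : IsIso (hi.to (⊥_ C)) := by
    change IsIso (hi.uniqueUpToIso initialIsInitial).hom
    infer_instance
  rw [fac]
  exact MorphismProperty.RespectsIso.precomp _ _ _ (hL _)

/-- The model structures on the slice categories. -/
theorem exists_modelCategory_over {L An : MorphismProperty C} (H : DirectedHomotopy L An)
    (S Λ : MorphismProperty C) [MorphismProperty.IsSmall.{v} S] [MorphismProperty.IsSmall.{v} Λ]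
    (hS : S.rlp.llp = L) (hΛ : Λ.rlp.llp = An) (hAn : An ≤ L)
    (hL : ∀ X : C, L (initial.to X)) (A : C) :
    ∃ _ : ModelCategory (Over A), (∀ {X Y : Over A} (f : X ⟶ Y), Cofibration f ↔ L f.left) ∧
      (∀ X : Over A, IsFibrant X ↔ An.rlp X.hom) := by
  have := hasLimitsOfSize_of_isLocallyPresentable C
  have := hasFactorization_llp_rlp S
  have := hasFactorization_llp_rlp Λ
  have hL' (X : Over A) : (L.over (X := A)) (initial.to X) := by
    have : L.RespectsIso := by rw [← hS]; infer_instance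
    exact initial_to_left_mem hL X
  obtain ⟨M, h₁, h₂⟩ := exists_modelCategory (H.over A) (overGenerators S A) (overGenerators Λ A)
    (by rw [llp_rlp_overGenerators, hS]) (by rw [llp_rlp_overGenerators, hΛ])
    (fun _ _ _ hf ↦ hAn _ hf) hL'
  exact ⟨M, h₁, fun X ↦ (h₂ X).trans (isNaiveFibrant_over_iff An X)⟩

end DirectedCylinder

/-! ### Uniqueness from cofibrations and fibrant objects -/

namespace DirectedCylinder

variable {D : Type u} [Category.{v} D]

section

variable [ModelCategory D]

/-- Morphisms inducing bijections on homotopy classes of maps to fibrant objects. -/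
def HomotopyBijective {X Y : D} (f : X ⟶ Y) : Prop := ∀ (F : D) [IsFibrant F],
  (∀ u : X ⟶ F, ∃ v : Y ⟶ F, LeftHomotopyRel (f ≫ v) u) ∧
    ∀ v v' : Y ⟶ F, LeftHomotopyRel (f ≫ v) (f ≫ v') → LeftHomotopyRel v v'

lemma HomotopyBijective.of_weakEquivalence {X Y : D} [IsCofibrant X] [IsCofibrant Y] (f : X ⟶ Y)
    [WeakEquivalence f] : HomotopyBijective f := by
  intro F _
  obtain ⟨h₁, h₂⟩ := RightHomotopyClass.precomp_bijective_of_weakEquivalence F f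
  refine ⟨fun u ↦ ?_, fun v v' h ↦ ?_⟩
  · obtain ⟨v, hv⟩ := h₂ (.mk u)
    obtain ⟨v, rfl⟩ := v.mk_surjective
    refine ⟨v, ?_⟩
    dsimp at hv
    rwa [RightHomotopyClass.mk_eq_mk_iff,
      ← leftHomotopyRel_iff_rightHomotopyRel] at hv
  · rw [leftHomotopyRel_iff_rightHomotopyRel] at h ⊢
    rw [← RightHomotopyClass.mk_eq_mk_iff] at h ⊢
    exact h₁ h

lemma HomotopyBijective.comp {X Y Z : D} [IsCofibrant X] {f : X ⟶ Y} {g : Y ⟶ Z}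
    (hf : HomotopyBijective f) (hg : HomotopyBijective g) : HomotopyBijective (f ≫ g) := by
  refine fun F _ ↦ ⟨fun u ↦ ?_, fun v v' h ↦ ?_⟩
  · obtain ⟨v, hv⟩ := (hf F).1 u
    obtain ⟨w, hw⟩ := (hg F).1 v
    exact ⟨w, by simpa using (hw.precomp f).trans hv⟩
  · simp only [Category.assoc] at h
    exact (hg F).2 _ _ ((hf F).2 _ _ h)

lemma HomotopyBijective.of_precomp {X Y Z : D} {f : X ⟶ Y} {g : Y ⟶ Z}
    (hf : HomotopyBijective f) (hfg : HomotopyBijective (f ≫ g)) : HomotopyBijective g := by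
  refine fun F _ ↦ ⟨fun v ↦ ?_, fun w w' h ↦ ?_⟩
  · obtain ⟨w, hw⟩ := (hfg F).1 (f ≫ v)
    exact ⟨w, (hf F).2 _ _ (by simpa using hw)⟩
  · exact (hfg F).2 _ _ (by simpa using h.precomp f)

/-- The covering homotopy property replaces `s` by a strict section `t`. Then `p ≫ t` is homotopic
to the identity, hence a weak equivalence, and `p` is a retract of it. -/
lemma weakEquivalence_of_homotopyEquivalence {E B : D} [IsCofibrant E] [IsCofibrant B]
    [IsFibrant E] (p : E ⟶ B) [Fibration p] (s : B ⟶ E) (h : LeftHomotopyRel (p ≫ s) (𝟙 E))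
    (h' : LeftHomotopyRel (s ≫ p) (𝟙 B)) : WeakEquivalence p := by
  obtain ⟨P, _, ⟨h'⟩⟩ := h'.exists_good_cylinder
  obtain ⟨t, k, hk⟩ := h'.covering_homotopy p s
  have ht : t ≫ p = 𝟙 B := by rw [← k.h₁, Category.assoc, hk, h'.h₁]
  obtain ⟨Q, ⟨l⟩⟩ := (k.symm.leftHomotopyRel.precomp p).trans h
  have hl : WeakEquivalence (p ≫ t) := by
    rw [l.weakEquivalence_iff]
    infer_instance
  rw [weakEquivalence_iff] at hl ⊢
  exact MorphismProperty.of_retract (g := p ≫ t)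
    { i := Arrow.homMk (𝟙 _) t
      r := Arrow.homMk (𝟙 _) p (by simp [ht])
      retract := by ext <;> simp [ht] } hl

/-- For the converse, `f` is replaced by a fibration between fibrant objects, which is still
bijective on homotopy classes and so has a homotopy inverse. -/
lemma weakEquivalence_iff_homotopyBijective (hD : ∀ X : D, IsCofibrant X) {X Y : D} (f : X ⟶ Y) :
    WeakEquivalence f ↔ HomotopyBijective f := by
  refine ⟨fun _ ↦ .of_weakEquivalence f, fun hf ↦ ?_⟩
  let r := MorphismProperty.factorizationData (trivialCofibrations D) (fibrations D)
    (terminal.from Y)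
  have hr : WeakEquivalence r.i := (weakEquivalence_iff _).2 r.hi.2
  have hrp : Fibration r.p := (fibration_iff _).2 r.hp
  have hY' : IsFibrant r.Z := by
    rwa [isFibrant_iff, Subsingleton.elim (terminal.from _) r.p]
  let φ := MorphismProperty.factorizationData (trivialCofibrations D) (fibrations D) (f ≫ r.i)
  have hi : WeakEquivalence φ.i := (weakEquivalence_iff _).2 φ.hi.2
  have hp : Fibration φ.p := (fibration_iff _).2 φ.hp
  have hX' : IsFibrant φ.Z := isFibrant_of_fibration φ.p
  have hφ : HomotopyBijective φ.p :=
    (HomotopyBijective.of_weakEquivalence φ.i).of_precomp (by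
      rw [φ.fac]
      exact hf.comp (.of_weakEquivalence r.i))
  obtain ⟨s, hs⟩ := (hφ φ.Z).1 (𝟙 _)
  have : WeakEquivalence φ.p := weakEquivalence_of_homotopyEquivalence φ.p s hs
    ((hφ r.Z).2 _ _ (by simpa using hs.postcomp φ.p))
  have : WeakEquivalence (f ≫ r.i) := by
    rw [← φ.fac]
    infer_instance
  exact weakEquivalence_of_postcomp f r.i

/-- For fibrant targets very good cylinders suffice, and these involve only cofibrations and maps
lifting against them. The right side therefore depends on the cofibrations alone. -/
lemma leftHomotopyRel_iff {X F : D} [IsFibrant F] (u v : X ⟶ F) :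
    LeftHomotopyRel u v ↔ ∃ (I : D) (i₀ i₁ : X ⟶ I) (π : I ⟶ X) (h : I ⟶ F),
      i₀ ≫ π = 𝟙 X ∧ i₁ ≫ π = 𝟙 X ∧ cofibrations D (coprod.desc i₀ i₁) ∧
        (cofibrations D).rlp π ∧ i₀ ≫ h = u ∧ i₁ ≫ h = v := by
  rw [MorphismProperty.rlp_eq_of_wfs (cofibrations D) (trivialFibrations D)]
  constructor
  · intro h
    obtain ⟨P, _, ⟨h⟩⟩ := h.exists_very_good_cylinder
    exact ⟨P.I, P.i₀, P.i₁, P.π, h.h, P.i₀_π, P.i₁_π, mem_cofibrations P.i,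
      mem_trivialFibrations P.π, h.h₀, h.h₁⟩
  · rintro ⟨I, i₀, i₁, π, h, e₀, e₁, -, hπ, h₀, h₁⟩
    let P : Cylinder X :=
      { I := I, i₀ := i₀, i₁ := i₁, π := π, i₀_π := e₀, i₁_π := e₁
        weakEquivalence_π := (weakEquivalence_iff _).2 hπ.2 }
    exact ⟨P, ⟨{ h := h, h₀ := h₀, h₁ := h₁ }⟩⟩

variable (D) in
lemma fibrations_eq_rlp : fibrations D = (cofibrations D ⊓ weakEquivalences D).rlp :=
  (MorphismProperty.rlp_eq_of_wfs (trivialCofibrations D) (fibrations D)).symm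

end

lemma weakEquivalences_eq (M₁ M₂ : ModelCategory D)
    (hcof : @cofibrations D _ M₁.categoryWithCofibrations =
      @cofibrations D _ M₂.categoryWithCofibrations)
    (hfib : ∀ X : D, @IsFibrant D _ M₁.categoryWithFibrations _ X ↔
      @IsFibrant D _ M₂.categoryWithFibrations _ X)
    (h₁ : ∀ X : D, @IsCofibrant D _ M₁.categoryWithCofibrations _ X)
    (h₂ : ∀ X : D, @IsCofibrant D _ M₂.categoryWithCofibrations _ X) :
    @weakEquivalences D _ M₁.categoryWithWeakEquivalences =
      @weakEquivalences D _ M₂.categoryWithWeakEquivalences := by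
  have hrel {X F : D} (hF₁ : @IsFibrant D _ M₁.categoryWithFibrations _ F)
      (hF₂ : @IsFibrant D _ M₂.categoryWithFibrations _ F) (u v : X ⟶ F) :
      @LeftHomotopyRel D _ M₁.categoryWithWeakEquivalences _ _ u v ↔
        @LeftHomotopyRel D _ M₂.categoryWithWeakEquivalences _ _ u v := by
    rw [@leftHomotopyRel_iff D _ M₁ _ _ hF₁, @leftHomotopyRel_iff D _ M₂ _ _ hF₂, hcof]
  ext X Y f
  refine (@weakEquivalence_iff D _ X Y f M₁.categoryWithWeakEquivalences).symm.trans
    (Iff.trans ?_ (@weakEquivalence_iff D _ X Y f M₂.categoryWithWeakEquivalences))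
  rw [@weakEquivalence_iff_homotopyBijective D _ M₁ h₁,
    @weakEquivalence_iff_homotopyBijective D _ M₂ h₂]
  refine forall_congr' (fun F ↦ ⟨fun h hF ↦ ?_, fun h hF ↦ ?_⟩)
  · have hF' := (hfib F).2 hF
    have := @h hF'
    simpa only [hrel hF' hF] using this
  · have hF' := (hfib F).1 hF
    have := @h hF'
    simpa only [hrel hF hF'] using this

/-- A model structure in which all objects are cofibrant is determined by its cofibrations and its
fibrant objects. -/
theorem modelCategory_ext (M₁ M₂ : ModelCategory D)
    (hcof : @cofibrations D _ M₁.categoryWithCofibrations =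
      @cofibrations D _ M₂.categoryWithCofibrations)
    (hfib : ∀ X : D, @IsFibrant D _ M₁.categoryWithFibrations _ X ↔
      @IsFibrant D _ M₂.categoryWithFibrations _ X)
    (h₁ : ∀ X : D, @IsCofibrant D _ M₁.categoryWithCofibrations _ X)
    (h₂ : ∀ X : D, @IsCofibrant D _ M₂.categoryWithCofibrations _ X) : M₁ = M₂ := by
  have hW := weakEquivalences_eq M₁ M₂ hcof hfib h₁ h₂
  have hF : @fibrations D _ M₁.categoryWithFibrations =
      @fibrations D _ M₂.categoryWithFibrations := by
    rw [@fibrations_eq_rlp D _ M₁, @fibrations_eq_rlp D _ M₂, hcof, hW]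
  -- Apart from the three classes, a model structure consists of propositions.
  obtain ⟨⟨F₁⟩, ⟨C₁⟩, ⟨W₁⟩⟩ := M₁
  obtain ⟨⟨F₂⟩, ⟨C₂⟩, ⟨W₂⟩⟩ := M₂
  obtain rfl : F₁ = F₂ := hF
  obtain rfl : C₁ = C₂ := hcof
  obtain rfl : W₁ = W₂ := hW
  rfl

variable {C : Type u} [Category.{v} C] [IsLocallyPresentable.{v} C]

/-- Existence and uniqueness of the model structures on the slice categories. -/
theorem existsUnique_modelCategory_over {L An : MorphismProperty C} (H : DirectedHomotopy L An)
    (S Λ : MorphismProperty C) [MorphismProperty.IsSmall.{v} S] [MorphismProperty.IsSmall.{v} Λ]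
    (hS : S.rlp.llp = L) (hΛ : Λ.rlp.llp = An) (hAn : An ≤ L)
    (hL : ∀ X : C, L (initial.to X)) (A : C) :
    ∃! _ : ModelCategory (Over A), (∀ {X Y : Over A} (f : X ⟶ Y), Cofibration f ↔ L f.left) ∧
      (∀ X : Over A, IsFibrant X ↔ An.rlp X.hom) := by
  obtain ⟨M, hM⟩ := exists_modelCategory_over H S Λ hS hΛ hAn hL A
  have : L.RespectsIso := by rw [← hS]; infer_instance
  refine ⟨M, hM, fun M' hM' ↦ modelCategory_ext M' M ?_ (fun X ↦ ?_) (fun X ↦ ?_) (fun X ↦ ?_)⟩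
  · ext X Y f
    exact (@cofibration_iff _ _ _ _ f M'.categoryWithCofibrations).symm.trans
      ((hM'.1 f).trans ((hM.1 f).symm.trans
        (@cofibration_iff _ _ _ _ f M.categoryWithCofibrations)))
  · exact (hM'.2 X).trans (hM.2 X).symm
  · exact (hM'.1 _).2 (initial_to_left_mem hL X)
  · exact (hM.1 _).2 (initial_to_left_mem hL X)

end DirectedCylinder

theorem mainTheorem3 {C : Type u} [Category.{v} C] [IsLocallyPresentable.{v} C]
    (L R : MorphismProperty C)
    (hLR : DirectedCylinder.IsCofibrantlyGeneratedWFS L R)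
    (hL : ∀ X : C, L (initial.to X))
    (cyl : DirectedCylinder.FunctorialCylinder L) (hcyl : cyl.IsExact) :
    (∀ An : MorphismProperty C, cyl.IsRightAnodyneClass An → ∀ A : C,
      ∃! M : ModelCategory (Over A),
        (∀ {X Y : Over A} (f : X ⟶ Y), Cofibration f ↔ L f.left) ∧
        (∀ X : Over A, IsFibrant X ↔ An.rlp X.hom)) ∧
    (∀ An : MorphismProperty C, cyl.IsLeftAnodyneClass An → ∀ A : C,
      ∃! M : ModelCategory (Over A),
        (∀ {X Y : Over A} (f : X ⟶ Y), Cofibration f ↔ L f.left) ∧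
        (∀ X : Over A, IsFibrant X ↔ An.rlp X.hom)) := by
  obtain ⟨S, _, -, hS⟩ := hLR.exists_generators
  refine ⟨fun An hAn A ↦ ?_, fun An hAn A ↦ ?_⟩
  · obtain ⟨Λ, _, -, hΛ⟩ := hAn.exists_generators
    exact DirectedCylinder.existsUnique_modelCategory_over (hcyl.rightDirectedHomotopy hL hAn) S Λ hS.symm hΛ.symm
      hAn.le hL A
  · obtain ⟨Λ, _, -, hΛ⟩ := hAn.exists_generators
    exact DirectedCylinder.existsUnique_modelCategory_over (hcyl.leftDirectedHomotopy hL hAn) S Λ hS.symm hΛ.symm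
      hAn.le hL A
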